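/- Let $k$ be an algebraically closed field of characteristic $0$, and let $G$ be a reductive linear algebraic group over $k$, i.e. a Zariski closed subgroup of some $\mathrm{GL}_n(k)$, not necessarily connected, having no nontrivial closed connected normal unipotent subgroup. Let $(A,\mathfrak m)$ and $(B,\mathfrak n)$ be complete local $k$-algebras such that $A/\mathfrak m^{r+1}$ and $B/\mathfrak n^{r+1}$ are finite-dimensional over $k$ for all $r$. A *formal isomorphism* $u=\{u_r\}$ between $(A,\mathfrak m)$ and $(B,\mathfrak n)$ is a collection of $k$-algebra isomorphisms $u_r\colon A/\mathfrak m^{r+1}\to B/\mathfrak n^{r+1}$ compatible with the natural projections $A/\mathfrak m^{s+1}\to A/\mathfrak m^{r+1}$ and $B/\mathfrak n^{s+1}\to B/\mathfrak n^{r+1}$ for $s>r$. An *action* of $G$ on $(A,\mathfrak m)$ is a sequence of homomorphisms of algebraic groups $G\to \mathrm{Aut}_{k\text{-alg}}(A/\mathfrak m^{r+1})$, compatible with the natural projections for $s>r$; likewise for $B$. Suppose that $G$ acts on $(A,\mathfrak m)$ and on $(B,\mathfrak n)$, and that there is a formal isomorphism $u$ between $(A,\mathfrak m)$ and $(B,\mathfrak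 n)$ for which $u_1\colon A/\mathfrak m^2\to B/\mathfrak n^2$ is $G$-equivariant. Then there is a $G$-equivariant formal isomorphism between $(A,\mathfrak m)$ and $(B,\mathfrak n)$, i.e. a formal isomorphism $v=\{v_r\}$ such that $v_r$ is $G$-equivariant for every $r$. -/

import Mathlib

/-!
Linear algebraic groups over an algebraically closed field `k` are given by their groups of
`k`-points, as Zariski closed subgroups of `GL (Fin n) k`.
-/

namespace StarrLift

section AlgebraicGroups

variable {k : Type*} [Field k] {n : ℕ}

/-- A subset of `GL_n(k)` is Zariski closed if it is the zero locus of a set of polynomials in the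
matrix entries. (Allowing `det⁻¹` in the equations gives the same closed sets.) -/
def IsZariskiClosed (S : Set (GL (Fin n) k)) : Prop :=
  ∃ I : Set (MvPolynomial (Fin n × Fin n) k), ∀ g : GL (Fin n) k,
    g ∈ S ↔ ∀ p ∈ I, MvPolynomial.eval (fun ij => (g : Matrix (Fin n) (Fin n) k) ij.1 ij.2) p = 0

/-- Connectedness of a nonempty subset for the Zariski topology: the subset is not covered by two
closed sets which both meet it and have no common point in it. -/
def IsZariskiConnected (S : Set (GL (Fin n) k)) : Prop :=
  S.Nonempty ∧ ∀ Z₁ Z₂ : Set (GL (Fin n) k), IsZariskiClosed Z₁ → IsZariskiClosed Z₂ →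
    S ⊆ Z₁ ∪ Z₂ → (S ∩ Z₁).Nonempty → (S ∩ Z₂).Nonempty → (S ∩ (Z₁ ∩ Z₂)).Nonempty

/-- A subgroup of `GL_n(k)` is unipotent if `g - 1` is a nilpotent matrix for each element `g`. -/
def IsUnipotentSubgroup (U : Subgroup (GL (Fin n) k)) : Prop :=
  ∀ g ∈ U, IsNilpotent ((g : Matrix (Fin n) (Fin n) k) - 1)

/-- A reductive linear algebraic group (not necessarily connected): a Zariski closed subgroup of
`GL_n(k)` with trivial unipotent radical, that is, with no nontrivial closed connected normal
unipotent subgroup. -/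
def IsReductive (G : Subgroup (GL (Fin n) k)) : Prop :=
  IsZariskiClosed (G : Set (GL (Fin n) k)) ∧
    ∀ U : Subgroup (GL (Fin n) k), U ≤ G → (U.subgroupOf G).Normal →
      IsZariskiClosed (U : Set (GL (Fin n) k)) → IsZariskiConnected (U : Set (GL (Fin n) k)) →
      IsUnipotentSubgroup U → U = ⊥

/-- Regular functions on the closed subgroup `G` of `GL_n(k)`: restrictions of polynomials in the
entries of `g` and of `g⁻¹`. -/
def IsRegularFun {G : Subgroup (GL (Fin n) k)} (f : G → k) : Prop :=
  ∃ p : MvPolynomial ((Fin n × Fin n) ⊕ (Fin n × Fin n)) k, ∀ g : G,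
    f g = MvPolynomial.eval (Sum.elim
      (fun ij => ((g : GL (Fin n) k) : Matrix (Fin n) (Fin n) k) ij.1 ij.2)
      (fun ij => (((g : GL (Fin n) k)⁻¹ : GL (Fin n) k) : Matrix (Fin n) (Fin n) k) ij.1 ij.2)) p

end AlgebraicGroups

section Formal

variable (k : Type*) [Field k]

/-- The truncation `A / 𝔪 ^ (r + 1)` of a local ring `(A, 𝔪)`. -/
abbrev Trunc (A : Type*) [CommRing A] [IsLocalRing A] (r : ℕ) : Type _ :=
  A ⧸ (IsLocalRing.maximalIdeal A ^ (r + 1))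

/-- The natural projection `A / 𝔪 ^ (s + 1) → A / 𝔪 ^ (r + 1)` for `r ≤ s`. -/
def Trunc.proj (A : Type*) [CommRing A] [IsLocalRing A] [Algebra k A] {r s : ℕ} (h : r ≤ s) :
    Trunc A s →ₐ[k] Trunc A r :=
  Ideal.Quotient.factorₐ k (Ideal.pow_le_pow_right (Nat.succ_le_succ h))

/-- A formal isomorphism between local `k`-algebras `(A, 𝔪)` and `(B, 𝔫)`: a compatible collection
of `k`-algebra isomorphisms `u_r : A / 𝔪 ^ (r + 1) ≃ B / 𝔫 ^ (r + 1)`. -/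
structure FormalIso (A B : Type*) [CommRing A] [IsLocalRing A] [Algebra k A]
    [CommRing B] [IsLocalRing B] [Algebra k B] where
  /-- The isomorphism `u_r`. -/
  iso (r : ℕ) : Trunc A r ≃ₐ[k] Trunc B r
  compat {r s : ℕ} (h : r ≤ s) (x : Trunc A s) :
    Trunc.proj k B h (iso s x) = iso r (Trunc.proj k A h x)

variable {k}

/-- An (algebraic) action of the linear algebraic group `G` on the local `k`-algebra `(A, 𝔪)`:
a compatible sequence of homomorphisms of algebraic groups from `G` to the groups of `k`-algebra
automorphisms of `A / 𝔪 ^ (r + 1)`. By compatibility, `(act s g)_s` is a formal automorphism for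
each `g`, so that each `act r g` automatically extends to a formal automorphism. -/
structure FormalAction {n : ℕ} (G : Subgroup (GL (Fin n) k))
    (A : Type*) [CommRing A] [IsLocalRing A] [Algebra k A] where
  /-- The action of `G` on `A / 𝔪 ^ (r + 1)`. -/
  act (r : ℕ) : G →* (Trunc A r ≃ₐ[k] Trunc A r)
  compat {r s : ℕ} (h : r ≤ s) (g : G) (x : Trunc A s) :
    Trunc.proj k A h (act s g x) = act r g (Trunc.proj k A h x)
  /-- The action on `A / 𝔪 ^ (r + 1)` is algebraic: its matrix coefficients are regular. -/
  regular (r : ℕ) (x : Trunc A r) (l : Module.Dual k (Trunc A r)) :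
    IsRegularFun (fun g : G => l (act r g x))

/-- The `r`-th component of a formal isomorphism is `G`-equivariant. -/
def FormalIso.IsEquivariantAt {n : ℕ} {G : Subgroup (GL (Fin n) k)}
    {A B : Type*} [CommRing A] [IsLocalRing A] [Algebra k A]
    [CommRing B] [IsLocalRing B] [Algebra k B]
    (u : FormalIso k A B) (a : FormalAction G A) (b : FormalAction G B) (r : ℕ) : Prop :=
  ∀ (g : G) (x : Trunc A r), u.iso r (a.act r g x) = b.act r g (u.iso r x)

end Formal

end StarrLift

set_option linter.unusedSectionVars false

namespace StarrLift

open Module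

/-! The proof is by successive approximation. Given a formal isomorphism `w` equivariant at level `r
≥ 1`, consider all formal isomorphisms agreeing with it at level `r`. Their components at level `r +
1` form an affine subspace `w₁ + Q` of the linear maps `A/𝔪^(r+2) → B/𝔫^(r+2)`, stable under
conjugation by `G`. That `Q` is linear (`FormalIso.deformations`) has two reasons: automorphisms
trivial at level `r` compose additively at level `r + 1`, and each is unipotent at every level, so
it has binomial powers `θ ^ t` for all `t` in `k`. A fixed point of `G` on `w₁ + Q` is a correction
equivariant at level `r + 1` (`FormalIso.exists_isEquivariantAt_succ`), and the corrections
stabilise at each level.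

The fixed point exists because reductive groups in characteristic zero are linearly reductive
(`IsReductive.linearlyReductive`). This is proved with the Lie algebra `𝔤` of left invariant
derivations of `k[G]`, from two inputs. By Engel's theorem, a stable subalgebra of `𝔤` acting
nilpotently on the standard representation respects a flag; its exponentials then lie in a closed
normal unipotent subgroup, so reductivity makes it zero (`IsReductive.eq_bot_of_isNilpotent`). And
by a Cartan type criterion, an element of `𝔤` whose action is trace-orthogonal to that of all its
replicas acts nilpotently (`isNilpotent_dAct_of_trace`).

For a representation `W` these inputs split `𝔤` into the kernel of the action on `W` and a
complement `b` on which the trace form of `W` is nondegenerate (`exists_invariant`). If `b ≠ 0`, its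
Casimir operator reduces the problem to a smaller representation. If `b = 0`, then `𝔤` kills `W`,
orbits of `G` are finite (`finite_orbit`), and averaging gives the invariant. -/

/-- An algebra of functions on a group which is closed under comultiplication. -/
structure FunctionAlgebra (k G A : Type*) [Field k] [Group G] [CommRing A] [Algebra k A] where
  /-- Evaluation at a point. -/
  ev : G → A →ₐ[k] k
  ext_ev {f f' : A} : (∀ g, ev g f = ev g f') → f = f'
  exists_comul (f : A) : ∃ (ι : Type) (_ : Fintype ι) (p q : ι → A),
    ∀ h g : G, ev (h * g) f = ∑ i, ev h (p i) * ev g (q i)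

/-! ### Left invariant derivations and their action on rational representations -/

section LeftInvariantDerivations

universe u v w

variable {k : Type u} [Field k] {G : Type v} [Group G] {A : Type w} [CommRing A] [Algebra k A]

namespace FunctionAlgebra

variable (E : FunctionAlgebra k G A)

/-- Freezing one variable in the comultiplication gives the translate. It is unique by `ext_ev`,
which is why the chosen functions `lFun` and `rFun` assemble into algebra homomorphisms. -/
lemma exists_left (h : G) (f : A) : ∃ f' : A, ∀ g, E.ev g f' = E.ev (h * g) f := by
  obtain ⟨ι, _, p, q, H⟩ := E.exists_comul f
  exact ⟨∑ i, E.ev h (p i) • q i, fun g => by simp [H]⟩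

lemma exists_right (g : G) (f : A) : ∃ f' : A, ∀ h, E.ev h f' = E.ev (h * g) f := by
  obtain ⟨ι, _, p, q, H⟩ := E.exists_comul f
  exact ⟨∑ i, E.ev g (q i) • p i, fun h => by simp [H, mul_comm]⟩

/-- The function underlying left translation. -/
noncomputable def lFun (h : G) (f : A) : A := (E.exists_left h f).choose

lemma ev_lFun (h g : G) (f : A) : E.ev g (E.lFun h f) = E.ev (h * g) f :=
  (E.exists_left h f).choose_spec g

/-- Left translation `f ↦ f (h * ·)`. -/
noncomputable def lTrans (h : G) : A →ₐ[k] A where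
  toFun := E.lFun h
  map_one' := E.ext_ev fun g => by simp [ev_lFun]
  map_mul' _ _ := E.ext_ev fun g => by simp [ev_lFun]
  map_zero' := E.ext_ev fun g => by simp [ev_lFun]
  map_add' _ _ := E.ext_ev fun g => by simp [ev_lFun]
  commutes' _ := E.ext_ev fun g => by simp [ev_lFun]

/-- The function underlying right translation. -/
noncomputable def rFun (g : G) (f : A) : A := (E.exists_right g f).choose

lemma ev_rFun (h g : G) (f : A) : E.ev h (E.rFun g f) = E.ev (h * g) f :=
  (E.exists_right g f).choose_spec h

/-- Right translation `f ↦ f (· * g)`. -/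
noncomputable def rTrans (g : G) : A →ₐ[k] A where
  toFun := E.rFun g
  map_one' := E.ext_ev fun h => by simp [ev_rFun]
  map_mul' _ _ := E.ext_ev fun h => by simp [ev_rFun]
  map_zero' := E.ext_ev fun h => by simp [ev_rFun]
  map_add' _ _ := E.ext_ev fun h => by simp [ev_rFun]
  commutes' _ := E.ext_ev fun h => by simp [ev_rFun]

@[simp] lemma ev_lTrans (h g : G) (f : A) : E.ev g (E.lTrans h f) = E.ev (h * g) f :=
  E.ev_lFun h g f

@[simp] lemma ev_rTrans (g h : G) (f : A) : E.ev h (E.rTrans g f) = E.ev (h * g) f :=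
  E.ev_rFun h g f

lemma rTrans_rTrans (g h : G) (f : A) : E.rTrans g (E.rTrans h f) = E.rTrans (g * h) f :=
  E.ext_ev fun x => by simp [mul_assoc]

lemma rTrans_one (f : A) : E.rTrans 1 f = f := E.ext_ev fun x => by simp

lemma lTrans_rTrans (g h : G) (f : A) :
    E.lTrans h (E.rTrans g f) = E.rTrans g (E.lTrans h f) :=
  E.ext_ev fun x => by simp [mul_assoc]

/-- The Lie algebra of left invariant derivations. -/
def lieAlg : LieSubalgebra k (Derivation k A A) where
  carrier := {D | ∀ h f, D (E.lTrans h f) = E.lTrans h (D f)}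
  add_mem' hD hD' h f := by simp [hD h f, hD' h f]
  zero_mem' h f := by simp
  smul_mem' c D hD h f := by simp [hD h f]
  lie_mem' {D D'} hD hD' h f := by
    simp only [Derivation.commutator_apply, map_sub]
    rw [hD' h f, hD h f, hD, hD']

variable {E} in
lemma lieAlg_lTrans (D : E.lieAlg) (h : G) (f : A) :
    D.1 (E.lTrans h f) = E.lTrans h (D.1 f) := D.2 h f

-- A left invariant derivation is determined by its tangent vector at the identity.
variable {E} in
lemma ev_lieAlg (D : E.lieAlg) (f : A) (h : G) :
    E.ev h (D.1 f) = E.ev 1 (D.1 (E.lTrans h f)) := by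
  simp [lieAlg_lTrans]

/-- Conjugation of a derivation by a right translation. -/
noncomputable def conjDer (g : G) (D : Derivation k A A) : Derivation k A A :=
  Derivation.mk' ((E.rTrans g).toLinearMap ∘ₗ (D : A →ₗ[k] A) ∘ₗ (E.rTrans g⁻¹).toLinearMap)
    fun a b => by
      change E.rTrans g (D (E.rTrans g⁻¹ (a * b))) =
        a * E.rTrans g (D (E.rTrans g⁻¹ b)) + b * E.rTrans g (D (E.rTrans g⁻¹ a))
      rw [map_mul, D.leibniz, map_add, smul_eq_mul, smul_eq_mul, map_mul, map_mul, rTrans_rTrans,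
        rTrans_rTrans, mul_inv_cancel, rTrans_one, rTrans_one]

lemma conjDer_apply (g : G) (D : Derivation k A A) (f : A) :
    E.conjDer g D f = E.rTrans g (D (E.rTrans g⁻¹ f)) := rfl

/-- The adjoint action of the group on left invariant derivations. -/
noncomputable def Ad (g : G) : E.lieAlg →ₗ[k] E.lieAlg where
  toFun D := ⟨E.conjDer g D.1, fun h f => by
    rw [conjDer_apply, conjDer_apply, ← lTrans_rTrans, lieAlg_lTrans, lTrans_rTrans]⟩
  map_add' D D' := Subtype.ext <| Derivation.ext fun f =>
    map_add (E.rTrans g) (D.1 (E.rTrans g⁻¹ f)) (D'.1 (E.rTrans g⁻¹ f))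
  map_smul' c D := Subtype.ext <| Derivation.ext fun f =>
    map_smul (E.rTrans g) c (D.1 (E.rTrans g⁻¹ f))

lemma Ad_apply (g : G) (D : E.lieAlg) (f : A) :
    (E.Ad g D).1 f = E.rTrans g (D.1 (E.rTrans g⁻¹ f)) := rfl

lemma Ad_Ad_inv (g : G) (D : E.lieAlg) : E.Ad g (E.Ad g⁻¹ D) = D := by
  refine Subtype.ext <| Derivation.ext fun f => ?_
  rw [Ad_apply, Ad_apply, rTrans_rTrans, rTrans_rTrans, inv_inv, mul_inv_cancel, rTrans_one,
    rTrans_one]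

variable {E} in
lemma lie_coe_apply (D D' : E.lieAlg) (f : A) :
    (⁅D, D'⁆ : E.lieAlg).1 f = D.1 (D'.1 f) - D'.1 (D.1 f) := rfl

/-- A representation is rational if its matrix coefficients lie in the given algebra of
functions. -/
def IsRational {W : Type*} [AddCommGroup W] [Module k W] (ρ : Representation k G W) : Prop :=
  ∀ (l : Dual k W) (x : W), ∃ f : A, ∀ g, E.ev g f = l (ρ g x)

end FunctionAlgebra

variable {E : FunctionAlgebra k G A}
variable {W : Type*} [AddCommGroup W] [Module k W] {ρ : Representation k G W}

namespace FunctionAlgebra.IsRational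

/-- The function underlying `coef`. -/
noncomputable def coefFun (hρ : E.IsRational ρ) (l : Dual k W) (x : W) : A := (hρ l x).choose

lemma ev_coefFun (hρ : E.IsRational ρ) (l : Dual k W) (x : W) (g : G) :
    E.ev g (hρ.coefFun l x) = l (ρ g x) := (hρ l x).choose_spec g

/-- A matrix coefficient of a rational representation. -/
noncomputable def coef (hρ : E.IsRational ρ) (l : Dual k W) : W →ₗ[k] A where
  toFun := hρ.coefFun l
  map_add' x y := E.ext_ev fun g => by simp [ev_coefFun]
  map_smul' c x := E.ext_ev fun g => by simp [ev_coefFun]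

@[simp] lemma ev_coef (hρ : E.IsRational ρ) (l : Dual k W) (x : W) (g : G) :
    E.ev g (hρ.coef l x) = l (ρ g x) := hρ.ev_coefFun l x g

lemma lTrans_coef (hρ : E.IsRational ρ) (l : Dual k W) (x : W) (h : G) :
    E.lTrans h (hρ.coef l x) = hρ.coef (l ∘ₗ ρ h) x :=
  E.ext_ev fun g => by simp

lemma rTrans_coef (hρ : E.IsRational ρ) (l : Dual k W) (x : W) (g : G) :
    E.rTrans g (hρ.coef l x) = hρ.coef l (ρ g x) :=
  E.ext_ev fun h => by simp

variable [FiniteDimensional k W]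

/-- The action of left invariant derivations on a rational representation. -/
noncomputable def dAct (hρ : E.IsRational ρ) : E.lieAlg →ₗ[k] End k W :=
  -- The vector is prescribed by its pairing with every `l`, namely the derivative at the identity
  -- of the coefficient `g ↦ l (ρ g x)`; finite dimension turns this element of the double dual into
  -- a vector.
  LinearMap.mk₂ k (fun D x => (evalEquiv k W).symm
    { toFun := fun l => E.ev 1 (D.1 (hρ.coef l x))
      map_add' := fun l l' => by
        have : hρ.coef (l + l') x = hρ.coef l x + hρ.coef l' x := E.ext_ev fun g => by simp
        simp [this]
      map_smul' := fun c l => by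
        have : hρ.coef (c • l) x = c • hρ.coef l x := E.ext_ev fun g => by simp
        simp [this] })
    (fun D E x => by rw [← map_add]; congr 1; ext l; simp)
    (fun c D x => by rw [← map_smul]; congr 1; ext l; simp)
    (fun D x y => by rw [← map_add]; congr 1; ext l; simp)
    (fun c D x => by rw [← map_smul]; congr 1; ext l; simp)

lemma dual_dAct (hρ : E.IsRational ρ) (l : Dual k W) (D : E.lieAlg) (x : W) :
    l (hρ.dAct D x) = E.ev 1 (D.1 (hρ.coef l x)) := by
  simp [dAct]

/-- Left translation by `h` replaces `l` by `l ∘ ρ h`, so left invariance moves the definition of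
`dAct` from the identity to every point. The algebraic properties of `dAct` below are read off from
this identity. -/
lemma apply_coef (hρ : E.IsRational ρ) (l : Dual k W) (D : E.lieAlg) (x : W) :
    D.1 (hρ.coef l x) = hρ.coef l (hρ.dAct D x) :=
  E.ext_ev fun h => by rw [ev_lieAlg, lTrans_coef, ← dual_dAct]; simp

end FunctionAlgebra.IsRational

lemma eq_of_forall_dual {x y : W} (h : ∀ l : Dual k W, l x = l y) : x = y := by
  rw [← sub_eq_zero, ← Module.forall_dual_apply_eq_zero_iff k]
  intro l; simp [h l]

namespace FunctionAlgebra.IsRational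

variable [FiniteDimensional k W]

lemma dAct_lie (hρ : E.IsRational ρ) (D D' : E.lieAlg) :
    hρ.dAct ⁅D, D'⁆ = hρ.dAct D * hρ.dAct D' - hρ.dAct D' * hρ.dAct D := by
  ext x
  refine eq_of_forall_dual (k := k) fun l => ?_
  rw [dual_dAct, lie_coe_apply, apply_coef, apply_coef,
    apply_coef, apply_coef, LinearMap.sub_apply, map_sub, map_sub]
  simp

lemma dAct_Ad (hρ : E.IsRational ρ) (g : G) (D : E.lieAlg) :
    hρ.dAct (E.Ad g D) = ρ g * hρ.dAct D * ρ g⁻¹ := by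
  ext x
  refine eq_of_forall_dual (k := k) fun l => ?_
  rw [dual_dAct, Ad_apply, rTrans_coef, apply_coef, rTrans_coef, ev_coef]
  simp

lemma dAct_of_invariant (hρ : E.IsRational ρ) (D : E.lieAlg) (l : Dual k W)
    (hl : ∀ g x, l (ρ g x) = l x) (x : W) : l (hρ.dAct D x) = 0 := by
  rw [dual_dAct]
  have : hρ.coef l x = algebraMap k A (l x) := E.ext_ev fun g => by simp [hl]
  rw [this, Derivation.map_algebraMap, map_zero]

end FunctionAlgebra.IsRational

end LeftInvariantDerivations

/-! ### Replicas and a Cartan type criterion for nilpotency -/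

section Replicas

/-- The iterates of `f` span a finite-dimensional stable subspace, where generalized eigenspaces
exhaust everything because `k` is algebraically closed. -/
lemma mem_iSup_maxGenEigenspace {k M : Type*} [Field k] [IsAlgClosed k] [AddCommGroup M]
    [Module k M] (D : End k M) (F : Submodule k M) [FiniteDimensional k F] (f : M)
    (hF : ∀ m : ℕ, (D ^ m) f ∈ F) : f ∈ ⨆ μ, D.maxGenEigenspace μ := by
  set K : Submodule k M := Submodule.span k (Set.range fun m : ℕ => (D ^ m) f) with hK
  have hKF : K ≤ F := Submodule.span_le.2 (by rintro _ ⟨m, rfl⟩; exact hF m)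
  have : FiniteDimensional k K := Submodule.finiteDimensional_of_le hKF
  have hDK : ∀ x ∈ K, D x ∈ K := by
    intro x hx
    have : K ≤ K.comap D := Submodule.span_le.2 (by
      rintro _ ⟨m, rfl⟩
      exact Submodule.subset_span ⟨m + 1, by simp [pow_succ']⟩)
    exact this hx
  have hf : f ∈ K := Submodule.subset_span ⟨0, by simp⟩
  have hle : ∀ μ, (End.maxGenEigenspace (LinearMap.restrict D hDK) μ).map K.subtype ≤
      D.maxGenEigenspace μ := by
    rintro μ _ ⟨x, hx, rfl⟩
    rw [SetLike.mem_coe, End.mem_maxGenEigenspace] at hx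
    obtain ⟨n, hn⟩ := hx
    rw [End.mem_maxGenEigenspace]
    refine ⟨n, ?_⟩
    have key : ∀ n : ℕ, ∀ y : K, ((D - μ • 1) ^ n) (y : M) =
        (((LinearMap.restrict D hDK - μ • 1) ^ n) y : K) := by
      intro n
      induction n with
      | zero => intro y; simp
      | succ n ih => intro y; rw [pow_succ, pow_succ]; simp [← ih]
    rw [Submodule.subtype_apply, key, hn]; rfl
  have h := congrArg (Submodule.map K.subtype)
    (End.iSup_maxGenEigenspace_eq_top (LinearMap.restrict D hDK))
  rw [Submodule.map_iSup, Submodule.map_top, Submodule.range_subtype] at h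
  exact (iSup_mono hle) (h.ge hf)

/-- The operator which acts on each generalized eigenspace of `D` by a scalar depending on the
eigenvalue. -/
lemma exists_scalar_on_maxGenEigenspace {k M : Type*} [Field k] [AddCommGroup M]
    [Module k M] (D : End k M) (h : ⨆ μ, D.maxGenEigenspace μ = ⊤) (φ : k → k) :
    ∃ S : End k M, ∀ μ, ∀ x ∈ D.maxGenEigenspace μ, S x = φ μ • x := by
  classical
  have hds := DirectSum.isInternal_submodule_of_iSupIndep_of_iSup_eq_top
      D.independent_maxGenEigenspace h
  let e := LinearEquiv.ofBijective (DirectSum.coeLinearMap D.maxGenEigenspace) hds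
  refine ⟨DirectSum.toModule k k M (fun μ => φ μ • (D.maxGenEigenspace μ).subtype) ∘ₗ
    e.symm.toLinearMap, fun μ x hx => ?_⟩
  have : e.symm x = DirectSum.lof k k (fun μ => D.maxGenEigenspace μ) μ ⟨x, hx⟩ := by
    rw [LinearEquiv.symm_apply_eq]
    exact (DirectSum.coeLinearMap_lof (R := k) D.maxGenEigenspace μ ⟨x, hx⟩).symm
  simp [this]

/-- The trace of `S * x`, where `S` is a scalar on each generalized eigenspace of `x`. -/
lemma trace_scalar_mul {k W : Type*} [Field k] [IsAlgClosed k] [AddCommGroup W]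
    [Module k W] [FiniteDimensional k W] (x S : End k W) (φ : k → k)
    (hS : ∀ μ, ∀ w ∈ x.maxGenEigenspace μ, S w = φ μ • w)
    (hfin : {μ | x.maxGenEigenspace μ ≠ ⊥}.Finite) :
    LinearMap.trace k W (S * x) =
      ∑ μ ∈ hfin.toFinset, φ μ * (μ * finrank k (x.maxGenEigenspace μ)) := by
  classical
  have hds := DirectSum.isInternal_submodule_of_iSupIndep_of_iSup_eq_top
      x.independent_maxGenEigenspace (End.iSup_maxGenEigenspace_eq_top x)
  have hx : ∀ μ, Set.MapsTo x (x.maxGenEigenspace μ) (x.maxGenEigenspace μ) := fun μ =>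
    x.mapsTo_maxGenEigenspace_of_comm rfl μ
  have hSx : ∀ μ, Set.MapsTo (S * x) (x.maxGenEigenspace μ) (x.maxGenEigenspace μ) := by
    intro μ w hw
    rw [End.mul_apply, hS μ _ (hx μ hw)]
    exact Submodule.smul_mem _ _ (hx μ hw)
  rw [LinearMap.trace_eq_sum_trace_restrict' hds hfin hSx]
  refine Finset.sum_congr rfl fun μ _ => ?_
  have h1 : (S * x).restrict (hSx μ) = φ μ • x.restrict (hx μ) := by
    ext w
    exact hS μ _ (hx μ w.2)
  have h2 := LinearMap.isNilpotent_trace_of_isNilpotent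
    (x.isNilpotent_restrict_maxGenEigenspace_sub_algebraMap μ)
  have h3 := h2.eq_zero
  have h4 : (x - algebraMap k (End k W) μ).restrict
      (x.mapsTo_maxGenEigenspace_of_comm (Algebra.mul_sub_algebraMap_commutes x μ) μ) =
      x.restrict (hx μ) - μ • LinearMap.id := by
    ext w; rfl
  rw [h4, map_sub, map_smul, LinearMap.trace_id, sub_eq_zero] at h3
  rw [h1, map_smul, h3]
  simp

/-- An operator is nilpotent if its products with all its rational replicas are traceless. -/
lemma isNilpotent_of_trace_scalar {k W : Type*} [Field k] [IsAlgClosed k] [CharZero k]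
    [AddCommGroup W] [Module k W] [FiniteDimensional k W] (x : End k W)
    (H : ∀ φ : k →+ ℚ, ∃ S : End k W,
      (∀ μ, ∀ w ∈ x.maxGenEigenspace μ, S w = (φ μ : k) • w) ∧
      LinearMap.trace k W (S * x) = 0) : IsNilpotent x := by
  have hfin : {μ | x.maxGenEigenspace μ ≠ ⊥}.Finite :=
      WellFoundedGT.finite_ne_bot_of_iSupIndep x.independent_maxGenEigenspace
  -- Applying a `ℚ`-linear `φ : k → ℚ` to the relation `∑ φ μ * μ * dim = 0` gives a sum of squares
  -- `∑ (φ μ) ^ 2 * dim = 0` in `ℚ`. Hence every such `φ` kills every eigenvalue, and the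
  -- eigenvalues are zero.
  have hzero : ∀ μ, x.maxGenEigenspace μ ≠ ⊥ → μ = 0 := by
    intro μ hμ
    rw [← Module.forall_dual_apply_eq_zero_iff ℚ]
    intro φ
    obtain ⟨S, hS, hS0⟩ := H φ.toAddMonoidHom
    rw [trace_scalar_mul x S _ hS hfin] at hS0
    have h := congrArg φ hS0
    have h2 : ∀ ν, φ ((φ ν : k) * (ν * finrank k (x.maxGenEigenspace ν))) =
        φ ν ^ 2 * finrank k (x.maxGenEigenspace ν) := by
      intro ν
      have : (φ ν : k) * (ν * finrank k (x.maxGenEigenspace ν)) =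
        (φ ν * finrank k (x.maxGenEigenspace ν) : ℚ) • ν := by
          rw [Rat.smul_def]; push_cast; ring
      rw [this, map_smul, smul_eq_mul]; ring
    rw [map_sum, map_zero] at h
    simp only [LinearMap.toAddMonoidHom_coe, h2] at h
    rw [Finset.sum_eq_zero_iff_of_nonneg (fun ν _ => by positivity)] at h
    have h3 := h μ (hfin.mem_toFinset.2 hμ)
    have h4 : finrank k (x.maxGenEigenspace μ) ≠ 0 := fun h0 =>
      hμ (Submodule.finrank_eq_zero.1 h0)
    simpa [h4] using h3
  have htop : x.maxGenEigenspace 0 = ⊤ := by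
    rw [eq_top_iff, ← End.iSup_maxGenEigenspace_eq_top x]
    refine iSup_le fun μ => ?_
    by_cases hμ : x.maxGenEigenspace μ = ⊥
    · simp [hμ]
    · rw [hzero μ hμ]
  rw [End.maxGenEigenspace_eq_genEigenspace_finrank] at htop
  refine ⟨finrank k W, ?_⟩
  ext w
  have : w ∈ x.genEigenspace 0 (finrank k W) := htop ▸ Submodule.mem_top
  simpa [End.mem_genEigenspace_nat] using this

lemma maxGenEigenspace_zero_of_isNilpotent {k W : Type*} [Field k]
    [AddCommGroup W] [Module k W] (x : End k W) (hx : IsNilpotent x) :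
    x.maxGenEigenspace 0 = ⊤ := by
  obtain ⟨n, hn⟩ := hx
  rw [eq_top_iff]
  intro w _
  rw [End.mem_maxGenEigenspace]
  exact ⟨n, by simp [hn]⟩

/-- By Leibniz, `D - (μ + ν)` acts on a product as `D - μ` on the first factor plus `D - ν` on the
second; the induction runs over the total of the two nilpotency exponents. -/
lemma mul_mem_maxGenEigenspace {k A : Type*} [Field k] [CommRing A] [Algebra k A]
    (D : Derivation k A A) {μ ν : k} {f f' : A}
    (hf : f ∈ End.maxGenEigenspace (D : A →ₗ[k] A) μ)
    (hf' : f' ∈ End.maxGenEigenspace (D : A →ₗ[k] A) ν) :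
    f * f' ∈ End.maxGenEigenspace (D : A →ₗ[k] A) (μ + ν) := by
  rw [End.mem_maxGenEigenspace] at *
  obtain ⟨a, ha⟩ := hf
  obtain ⟨b, hb⟩ := hf'
  have key : ∀ n a b : ℕ, a + b = n → ∀ f f' : A, (((D : A →ₗ[k] A) - μ • 1) ^ a) f = 0 →
      (((D : A →ₗ[k] A) - ν • 1) ^ b) f' = 0 →
      (((D : A →ₗ[k] A) - (μ + ν) • 1) ^ n) (f * f') = 0 := by
    intro n
    induction n with
    | zero =>
      intro a b hab f f' ha _
      obtain rfl : a = 0 := by omega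
      simp at ha
      simp [ha]
    | succ n ih =>
      intro a b hab f f' ha hb
      have h1 : ((D : A →ₗ[k] A) - (μ + ν) • 1) (f * f') =
          (((D : A →ₗ[k] A) - μ • 1) f) * f' + f * (((D : A →ₗ[k] A) - ν • 1) f') := by
        simp only [LinearMap.sub_apply, LinearMap.smul_apply, End.one_apply,
          Derivation.coeFn_coe, Derivation.leibniz, smul_eq_mul, sub_mul, mul_sub,
          smul_mul_assoc, mul_smul_comm, mul_comm f' (D f)]
        module
      rw [pow_succ, End.mul_apply, h1, map_add]
      have h2 : (((D : A →ₗ[k] A) - (μ + ν) • 1) ^ n)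
          ((((D : A →ₗ[k] A) - μ • 1) f) * f') = 0 := by
        rcases a with _ | a
        · simp at ha; simp [ha]
        · exact ih a b (by omega) _ _ (by rwa [pow_succ, End.mul_apply] at ha) hb
      have h3 : (((D : A →ₗ[k] A) - (μ + ν) • 1) ^ n)
          (f * (((D : A →ₗ[k] A) - ν • 1) f')) = 0 := by
        rcases b with _ | b
        · simp at hb; simp [hb]
        · exact ih a b (by omega) _ _ ha (by rwa [pow_succ, End.mul_apply] at hb)
      rw [h2, h3, add_zero]
  exact ⟨a + b, key _ a b rfl f f' ha hb⟩

variable {k G A : Type*} [Field k] [IsAlgClosed k] [Group G] [CommRing A] [Algebra k A]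

namespace FunctionAlgebra

/-- Left invariant derivations are locally finite: writing `f (h * g) = ∑ p i h * q i g`, all
iterates of `f` stay in the span of the `p i`. -/
lemma iSup_maxGenEigenspace_lieAlg {E : FunctionAlgebra k G A} (D : E.lieAlg) :
    ⨆ μ, End.maxGenEigenspace (D.1 : A →ₗ[k] A) μ = ⊤ := by
  rw [eq_top_iff]
  intro f _
  obtain ⟨ι, _, p, q, H⟩ := E.exists_comul f
  have : FiniteDimensional k (Submodule.span k (Set.range p)) :=
    FiniteDimensional.span_of_finite k (Set.finite_range p)
  refine mem_iSup_maxGenEigenspace _ (Submodule.span k (Set.range p)) f fun m => ?_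
  have hL : ∀ (m : ℕ) (h : G) (f : A),
      ((D.1 : A →ₗ[k] A) ^ m) (E.lTrans h f) = E.lTrans h (((D.1 : A →ₗ[k] A) ^ m) f) := by
    intro m
    induction m with
    | zero => simp
    | succ m ih =>
      intro h f
      rw [pow_succ, End.mul_apply, End.mul_apply, Derivation.coeFn_coe, lieAlg_lTrans, ih]
  have : ((D.1 : A →ₗ[k] A) ^ m) f = ∑ i, E.ev 1 (((D.1 : A →ₗ[k] A) ^ m) (q i)) • p i := by
    refine E.ext_ev fun h => ?_
    have h1 : E.lTrans h f = ∑ i, E.ev h (p i) • q i := E.ext_ev fun g => by simp [H]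
    have h2 := congrArg (E.ev 1) (hL m h f)
    rw [ev_lTrans, mul_one, h1] at h2
    rw [← h2]
    simp [mul_comm]
  rw [this]
  exact sum_mem fun i _ => Submodule.smul_mem _ _ (Submodule.subset_span ⟨i, rfl⟩)

/-- Replicas of a left invariant derivation. -/
lemma exists_replica {E : FunctionAlgebra k G A} (D : E.lieAlg) (φ : k →+ k) :
    ∃ D' : E.lieAlg, ∀ μ, ∀ f ∈ End.maxGenEigenspace (D.1 : A →ₗ[k] A) μ,
      D'.1 f = φ μ • f := by
  have htop := iSup_maxGenEigenspace_lieAlg D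
  obtain ⟨S, hS⟩ := exists_scalar_on_maxGenEigenspace _ htop φ
  -- Generalized eigenspaces multiply with eigenvalues adding, and `φ` is additive, so the scalar
  -- operator `S` is a derivation.
  have hmul : ∀ a b : A, S (a * b) = a • S b + b • S a := by
    intro a b
    have ha : a ∈ ⨆ μ, End.maxGenEigenspace (D.1 : A →ₗ[k] A) μ := htop ▸ Submodule.mem_top
    have hb : b ∈ ⨆ μ, End.maxGenEigenspace (D.1 : A →ₗ[k] A) μ := htop ▸ Submodule.mem_top
    induction ha using Submodule.iSup_induction' with
    | zero => simp
    | add x y _ _ hx hy => simp only [add_mul, map_add, hx, hy, smul_eq_mul]; ring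
    | mem μ a ha =>
      induction hb using Submodule.iSup_induction' with
      | zero => simp
      | add x y _ _ hx hy => simp only [mul_add, map_add, hx, hy, smul_eq_mul]; ring
      | mem ν b hb =>
        rw [hS _ _ ha, hS _ _ hb, hS _ _ (mul_mem_maxGenEigenspace _ ha hb), map_add]
        simp only [smul_eq_mul, mul_smul_comm, mul_comm b a]
        module
  refine ⟨⟨Derivation.mk' S hmul, fun h f => ?_⟩, fun μ f hf => hS μ f hf⟩
  -- Left translations commute with `D`, so they preserve its generalized eigenspaces and commute
  -- with `S`.
  change S (E.lTrans h f) = E.lTrans h (S f)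
  have hf : f ∈ ⨆ μ, End.maxGenEigenspace (D.1 : A →ₗ[k] A) μ := htop ▸ Submodule.mem_top
  induction hf using Submodule.iSup_induction' with
  | zero => simp
  | add x y _ _ hx hy => simp only [map_add, hx, hy]
  | mem μ f hf =>
    rw [hS μ f hf, hS μ, map_smul]
    rw [End.mem_maxGenEigenspace] at hf ⊢
    obtain ⟨n, hn⟩ := hf
    refine ⟨n, ?_⟩
    have hL : ∀ (m : ℕ) (f : A), (((D.1 : A →ₗ[k] A) - μ • 1) ^ m) (E.lTrans h f) =
        E.lTrans h ((((D.1 : A →ₗ[k] A) - μ • 1) ^ m) f) := by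
      intro m
      induction m with
      | zero => simp
      | succ m ih =>
        intro f
        rw [pow_succ, End.mul_apply, End.mul_apply, ← ih]
        simp [lieAlg_lTrans]
    rw [hL, hn, map_zero]

/-- A derivation `D'` is the replica of `D` along `φ`. -/
def IsReplica {E : FunctionAlgebra k G A} (D D' : E.lieAlg) (φ : k →+ k) : Prop :=
  ∀ μ, ∀ f ∈ End.maxGenEigenspace (D.1 : A →ₗ[k] A) μ, D'.1 f = φ μ • f

variable {E : FunctionAlgebra k G A}
variable {W : Type*} [AddCommGroup W] [Module k W] {ρ : Representation k G W}
variable [FiniteDimensional k W]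

lemma coef_mem_maxGenEigenspace (hρ : E.IsRational ρ) (D : E.lieAlg) (μ : k) (w : W)
    (hw : w ∈ (hρ.dAct D).maxGenEigenspace μ) (l : Dual k W) :
    hρ.coef l w ∈ End.maxGenEigenspace (D.1 : A →ₗ[k] A) μ := by
  rw [End.mem_maxGenEigenspace] at hw ⊢
  obtain ⟨n, hn⟩ := hw
  refine ⟨n, ?_⟩
  have key : ∀ (m : ℕ) (w : W), (((D.1 : A →ₗ[k] A) - μ • 1) ^ m) (hρ.coef l w) =
      hρ.coef l (((hρ.dAct D - μ • 1) ^ m) w) := by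
    intro m
    induction m with
    | zero => simp
    | succ m ih =>
      intro w
      rw [pow_succ, pow_succ, End.mul_apply, End.mul_apply, ← ih]
      simp [hρ.apply_coef]
  rw [key, hn, map_zero]

/-- A replica built once on the function algebra acts as a replica in every rational representation
simultaneously. This allows nilpotency to be compared between two representations. -/
lemma IsReplica.dAct_apply {D D' : E.lieAlg} {φ : k →+ k} (h : IsReplica D D' φ)
    (hρ : E.IsRational ρ) (μ : k) (w : W) (hw : w ∈ (hρ.dAct D).maxGenEigenspace μ) :
    hρ.dAct D' w = φ μ • w := by
  refine eq_of_forall_dual (k := k) fun l => ?_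
  rw [hρ.dual_dAct, h μ _ (coef_mem_maxGenEigenspace hρ D μ w hw l)]
  simp

lemma IsReplica.dAct_eq_zero {D D' : E.lieAlg} {φ : k →+ k} (h : IsReplica D D' φ)
    (hρ : E.IsRational ρ) (hD : IsNilpotent (hρ.dAct D)) : hρ.dAct D' = 0 := by
  ext w
  rw [h.dAct_apply hρ 0 w (by rw [maxGenEigenspace_zero_of_isNilpotent _ hD]; trivial)]
  simp

lemma isNilpotent_dAct_of_trace [CharZero k] (hρ : E.IsRational ρ) (D : E.lieAlg)
    (H : ∀ D' φ, IsReplica D D' φ → LinearMap.trace k W (hρ.dAct D' * hρ.dAct D) = 0) :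
    IsNilpotent (hρ.dAct D) := by
  refine isNilpotent_of_trace_scalar _ fun φ => ?_
  obtain ⟨D', hD'⟩ := exists_replica D ((Rat.castHom k).toAddMonoidHom.comp φ)
  exact ⟨hρ.dAct D', fun μ w hw => IsReplica.dAct_apply hD' hρ μ w hw, H D' _ hD'⟩

end FunctionAlgebra

end Replicas

/-! ### Vectors killed by the Lie algebra have finite orbits -/

section LocallyConstant

variable {k G A : Type*} [Field k] [Group G] [CommRing A] [Algebra k A]

namespace FunctionAlgebra

variable (E : FunctionAlgebra k G A)

/-- The maximal ideal of the identity. -/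
def idealOne : Ideal A := RingHom.ker (E.ev 1)

variable {E}

lemma mem_idealOne {f : A} : f ∈ E.idealOne ↔ E.ev 1 f = 0 := RingHom.mem_ker

lemma sub_mem_idealOne (f : A) : f - algebraMap k A (E.ev 1 f) ∈ E.idealOne := by
  simp [mem_idealOne]

/-- A tangent vector at the identity extends to a left invariant derivation. -/
lemma exists_lieAlg_of_pointDerivation (ξ : A →ₗ[k] k) (h1 : ξ 1 = 0)
    (h2 : ∀ f ∈ E.idealOne ^ 2, ξ f = 0) : ∃ D : E.lieAlg, ∀ f, E.ev 1 (D.1 f) = ξ f := by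
  -- Vanishing on `1` and on the square of the maximal ideal amounts to the Leibniz rule at the
  -- identity.
  have hξ : ∀ f f' : A, ξ (f * f') = E.ev 1 f * ξ f' + E.ev 1 f' * ξ f := by
    intro f f'
    have h3 : ξ ((f - algebraMap k A (E.ev 1 f)) * (f' - algebraMap k A (E.ev 1 f'))) = 0 :=
      h2 _ (by rw [pow_two]; exact Ideal.mul_mem_mul (sub_mem_idealOne f) (sub_mem_idealOne f'))
    have h4 : f * f' = (f - algebraMap k A (E.ev 1 f)) * (f' - algebraMap k A (E.ev 1 f')) +
        E.ev 1 f • f' + E.ev 1 f' • f - (E.ev 1 f * E.ev 1 f') • (1 : A) := by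
      simp only [Algebra.smul_def, map_mul]; ring
    rw [h4]
    simp [h3, h1]
  -- The derivation is `(D f) h = ξ (f (h * ·))`; comultiplication shows that this function of `h`
  -- lies in the algebra.
  have hex : ∀ f : A, ∃ f' : A, ∀ h, E.ev h f' = ξ (E.lTrans h f) := by
    intro f
    obtain ⟨ι, _, p, q, H⟩ := E.exists_comul f
    refine ⟨∑ i, ξ (q i) • p i, fun h => ?_⟩
    have : E.lTrans h f = ∑ i, E.ev h (p i) • q i := E.ext_ev fun g => by simp [H]
    rw [this]
    simp [mul_comm]
  choose d hd using hex
  let dl : A →ₗ[k] A :=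
    { toFun := d
      map_add' := fun f f' => E.ext_ev fun h => by simp [hd]
      map_smul' := fun c f => E.ext_ev fun h => by simp [hd] }
  refine ⟨⟨Derivation.mk' dl fun a b => E.ext_ev fun h => ?_, fun h f => E.ext_ev fun g => ?_⟩,
    fun f => ?_⟩
  · change E.ev h (d (a * b)) = E.ev h (a * d b + b * d a)
    simp [hd, hξ]
  · change E.ev g (d _) = E.ev g (E.lTrans h (d f))
    rw [hd, ev_lTrans, hd]
    congr 1
    exact E.ext_ev fun x => by simp [mul_assoc]
  · change E.ev 1 (d f) = _
    rw [hd]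
    congr 1
    exact E.ext_ev fun x => by simp

/-- Modulo constants and the square of the maximal ideal, a product is a linear combination of its
factors and `1`. Algebra generators therefore span the cotangent space, and a basis of it lifts to
the `t i`, with the dual tangent vectors extending to the `D i`. -/
lemma exists_dual_tangent_basis [Algebra.FiniteType k A] :
    ∃ (ι : Type) (_ : Fintype ι) (t : ι → A) (D : ι → E.lieAlg), (∀ i, t i ∈ E.idealOne) ∧
      ∀ f ∈ E.idealOne, f - ∑ i, E.ev 1 ((D i).1 f) • t i ∈ E.idealOne ^ 2 := by
  obtain ⟨s, hs⟩ := (inferInstance : Algebra.FiniteType k A).out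
  let N : Submodule k A := Submodule.span k {1} ⊔ (E.idealOne ^ 2).restrictScalars k
  have htop : Submodule.span k (s : Set A) ⊔ N = ⊤ := by
    rw [eq_top_iff]
    intro f _
    have hf : f ∈ Algebra.adjoin k (s : Set A) := hs ▸ Algebra.mem_top
    have h1 : (1 : A) ∈ Submodule.span k (s : Set A) ⊔ N :=
      le_sup_right (a := Submodule.span k (s : Set A))
        (le_sup_left (a := Submodule.span k {(1 : A)}) (Submodule.mem_span_singleton_self 1))
    induction hf using Algebra.adjoin_induction with
    | mem x hx => exact le_sup_left (b := N) (Submodule.subset_span hx)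
    | algebraMap r => rw [Algebra.algebraMap_eq_smul_one]; exact Submodule.smul_mem _ _ h1
    | add x y _ _ hx hy => exact add_mem (hx trivial) (hy trivial)
    | mul x y _ _ hx hy =>
      have h4 : x * y = (x - algebraMap k A (E.ev 1 x)) * (y - algebraMap k A (E.ev 1 y)) +
          E.ev 1 x • y + E.ev 1 y • x - (E.ev 1 x * E.ev 1 y) • (1 : A) := by
        simp only [Algebra.smul_def, map_mul]; ring
      have h5 : (x - algebraMap k A (E.ev 1 x)) * (y - algebraMap k A (E.ev 1 y)) ∈
          E.idealOne ^ 2 := by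
        rw [pow_two]; exact Ideal.mul_mem_mul (sub_mem_idealOne x) (sub_mem_idealOne y)
      have h6 : (x - algebraMap k A (E.ev 1 x)) * (y - algebraMap k A (E.ev 1 y)) ∈
          Submodule.span k (s : Set A) ⊔ N :=
        le_sup_right (a := Submodule.span k (s : Set A))
          (le_sup_right (a := Submodule.span k {(1 : A)}) h5)
      rw [h4]
      exact sub_mem (add_mem (add_mem h6 (Submodule.smul_mem _ _ (hy trivial)))
        (Submodule.smul_mem _ _ (hx trivial))) (Submodule.smul_mem _ _ h1)
  classical
  have hfin : Module.Finite k (A ⧸ N) := by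
    refine ⟨⟨s.image N.mkQ, ?_⟩⟩
    rw [Finset.coe_image, Submodule.span_image, ← Submodule.range_mkQ N, LinearMap.range_eq_map,
      ← htop, Submodule.map_sup, show N.map N.mkQ = ⊥ by simp, sup_bot_eq]
  let b := Module.finBasis k (A ⧸ N)
  choose t' ht' using fun i => N.mkQ_surjective (b i)
  have hξ : ∀ i, ∃ D : E.lieAlg, ∀ f, E.ev 1 (D.1 f) = (b.coord i ∘ₗ N.mkQ) f := by
    intro i
    refine exists_lieAlg_of_pointDerivation _ ?_ fun f hf => ?_
    · have : N.mkQ 1 = 0 := (Submodule.Quotient.mk_eq_zero N).2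
        (le_sup_left (a := Submodule.span k {(1 : A)}) (Submodule.mem_span_singleton_self 1))
      rw [LinearMap.comp_apply, this, map_zero]
    · have : N.mkQ f = 0 := (Submodule.Quotient.mk_eq_zero N).2
        (le_sup_right (a := Submodule.span k {(1 : A)}) hf)
      rw [LinearMap.comp_apply, this, map_zero]
  choose D hD using hξ
  refine ⟨_, inferInstance, fun i => t' i - algebraMap k A (E.ev 1 (t' i)), D,
    fun i => sub_mem_idealOne _, fun f hf => ?_⟩
  set y := f - ∑ i, E.ev 1 ((D i).1 f) • (t' i - algebraMap k A (E.ev 1 (t' i))) with hy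
  have hmk1 : ∀ c : k, N.mkQ (algebraMap k A c) = 0 := fun c => by
    rw [Algebra.algebraMap_eq_smul_one]
    exact (Submodule.Quotient.mk_eq_zero N).2 (Submodule.smul_mem _ _
      (le_sup_left (a := Submodule.span k {(1 : A)}) (Submodule.mem_span_singleton_self 1)))
  have hyN : y ∈ N := by
    rw [← Submodule.Quotient.mk_eq_zero N, ← Submodule.mkQ_apply, hy, map_sub, map_sum, sub_eq_zero]
    conv_lhs => rw [← b.sum_repr (N.mkQ f)]
    refine Finset.sum_congr rfl fun i _ => ?_
    rw [hD, map_smul, map_sub, hmk1, sub_zero, ht']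
    rfl
  obtain ⟨u, hu, v, hv, huv⟩ := Submodule.mem_sup.1 hyN
  obtain ⟨c, rfl⟩ := Submodule.mem_span_singleton.1 hu
  have hv0 : E.ev 1 v = 0 := mem_idealOne.1 (Ideal.pow_le_self (two_ne_zero) hv)
  have hy0 : E.ev 1 y = 0 := by
    rw [hy]; simp [mem_idealOne.1 hf]
  rw [← huv] at hy0
  have hc : c = 0 := by simpa [hv0] using hy0
  rw [← huv, hc, zero_smul, zero_add]
  exact hv

/-- A function in the maximal ideal of the identity which is killed by all left invariant
derivations is flat at the identity. -/
lemma mem_idealOne_pow [CharZero k] [Algebra.FiniteType k A] {f : A} (hf : f ∈ E.idealOne)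
    (hD : ∀ D : E.lieAlg, D.1 f = 0) (r : ℕ) : f ∈ E.idealOne ^ r := by
  obtain ⟨ι, _, t, D, ht, H⟩ := exists_dual_tangent_basis (E := E)
  -- An Euler operator: it acts as multiplication by `r` on `𝔪^r / 𝔪^(r+1)`, where `𝔪` is the ideal
  -- of the identity. It kills `f`, so `f ∈ 𝔪^r` forces `r * f ∈ 𝔪^(r+1)`, and `r` is invertible in
  -- `k` when positive.
  let e : A → A := fun f => ∑ i, t i * (D i).1 f
  have he_mul : ∀ a b, e (a * b) = a * e b + b * e a := by
    intro a b
    simp only [e, Derivation.leibniz, smul_eq_mul, Finset.mul_sum, ← Finset.sum_add_distrib]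
    exact Finset.sum_congr rfl fun i _ => by ring
  have he_add : ∀ a b, e (a + b) = e a + e b := by
    intro a b
    simp only [e, map_add, mul_add, Finset.sum_add_distrib]
  have he1 : ∀ a ∈ E.idealOne, e a - a ∈ E.idealOne ^ 2 := by
    intro a ha
    have h1 : e a - a = ∑ i, t i * ((D i).1 a - algebraMap k A (E.ev 1 ((D i).1 a))) -
        (a - ∑ i, E.ev 1 ((D i).1 a) • t i) := by
      simp only [e, mul_sub, Finset.sum_sub_distrib, Algebra.smul_def]
      rw [Finset.sum_congr rfl fun i _ => mul_comm (algebraMap k A (E.ev 1 ((D i).1 a))) (t i)]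
      ring
    rw [h1]
    refine sub_mem (sum_mem fun i _ => ?_) (H a ha)
    rw [pow_two]
    exact Ideal.mul_mem_mul (ht i) (sub_mem_idealOne _)
  have he : ∀ (r : ℕ), ∀ a ∈ E.idealOne ^ r, e a - r * a ∈ E.idealOne ^ (r + 1) := by
    intro r
    induction r with
    | zero =>
      intro a _
      simp only [Nat.cast_zero, zero_mul, sub_zero, zero_add, pow_one]
      exact sum_mem fun i _ => Ideal.mul_mem_right _ _ (ht i)
    | succ r ih =>
      intro a ha
      rw [pow_succ] at ha
      induction ha using Submodule.mul_induction_on' with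
      | mem_mul_mem a ha b hb =>
        have h1 : e (a * b) - ((r + 1 : ℕ) : A) * (a * b) =
            a * (e b - b) + (e a - r * a) * b := by
          rw [he_mul]; push_cast; ring
        rw [h1]
        refine add_mem ?_ ?_
        · rw [show r + 1 + 1 = r + 2 by ring, pow_add]
          exact Ideal.mul_mem_mul ha (he1 b hb)
        · rw [pow_succ]
          exact Ideal.mul_mem_mul (ih a ha) hb
      | add a _ b _ ha hb =>
        have h1 : e (a + b) - ((r + 1 : ℕ) : A) * (a + b) =
            (e a - ((r + 1 : ℕ) : A) * a) + (e b - ((r + 1 : ℕ) : A) * b) := by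
          rw [he_add]; ring
        rw [h1]
        exact add_mem ha hb
  have hef : e f = 0 := by simp [e, hD]
  induction r with
  | zero => simp
  | succ r ih =>
    -- In degree zero the Euler eigenvalue vanishes, and `hf` takes over.
    rcases Nat.eq_zero_or_pos r with rfl | hr
    · simpa using hf
    have h1 := he r f ih
    rw [hef, zero_sub, neg_mem_iff] at h1
    have h2 : f = algebraMap k A ((r : k)⁻¹) * (r * f) := by
      rw [← mul_assoc, ← map_natCast (algebraMap k A), ← map_mul,
        inv_mul_cancel₀ (by exact_mod_cast hr.ne'), map_one, one_mul]
    rw [h2]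
    exact Ideal.mul_mem_left _ _ h1

/-- Krull's intersection theorem applied to a flat function. Geometrically, `f` vanishes on the
neighbourhood `s ≠ 0` of the identity. -/
lemma exists_mul_eq_zero [CharZero k] [Algebra.FiniteType k A] {f : A} (hf : f ∈ E.idealOne)
    (hD : ∀ D : E.lieAlg, D.1 f = 0) : ∃ s : A, E.ev 1 s = 1 ∧ s * f = 0 := by
  have : IsNoetherianRing A := Algebra.FiniteType.isNoetherianRing k A
  have h1 : f ∈ (⨅ i : ℕ, E.idealOne ^ i • ⊤ : Submodule A A) := by
    simp only [Submodule.mem_iInf, smul_eq_mul, Ideal.mul_top]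
    exact mem_idealOne_pow hf hD
  obtain ⟨r, hr⟩ := (E.idealOne.mem_iInf_smul_pow_eq_bot_iff f).1 h1
  refine ⟨1 - r, ?_, ?_⟩
  · simp [mem_idealOne.1 r.2]
  · rw [smul_eq_mul] at hr
    rw [sub_mul, hr, one_mul, sub_self]

/-- A vector killed by all left invariant derivations has a finite orbit. -/
lemma finite_orbit [CharZero k] [Algebra.FiniteType k A]
    {W : Type*} [AddCommGroup W] [Module k W] [FiniteDimensional k W] {ρ : Representation k G W}
    (hρ : E.IsRational ρ) (w : W) (hw : ∀ D : E.lieAlg, hρ.dAct D w = 0) :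
    (Set.range fun g => ρ g w).Finite := by
  have : IsNoetherianRing A := Algebra.FiniteType.isNoetherianRing k A
  let b := Module.finBasis k W
  have h1 : ∀ i, ∃ s : A, E.ev 1 s = 1 ∧
      s * (hρ.coef (b.coord i) w - algebraMap k A (b.coord i w)) = 0 := by
    intro i
    refine exists_mul_eq_zero (by simp [mem_idealOne]) fun D => ?_
    rw [map_sub, Derivation.map_algebraMap, hρ.apply_coef, hw]
    simp
  choose s hs1 hs using h1
  let S := ∏ i, s i
  have hS1 : E.ev 1 S = 1 := by simp [S, hs1]
  -- The orbit map of `w` is constant on the neighbourhood `S ≠ 0` of the identity.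
  have hS : ∀ g, E.ev g S ≠ 0 → ρ g w = w := by
    intro g hg
    refine b.ext_elem fun i => ?_
    have h2 := congrArg (E.ev g) (hs i)
    rw [map_mul, map_zero, mul_eq_zero] at h2
    rcases h2 with h2 | h2
    · exact absurd (by simp only [S, map_prod]; exact Finset.prod_eq_zero (Finset.mem_univ i) h2) hg
    · simpa [sub_eq_zero] using h2
  -- The translates of this neighbourhood cover the group. By noetherianity finitely many of them
  -- suffice, and the orbit map is constant on each.
  let J : Ideal A := Ideal.span (Set.range fun g : G => E.lTrans g⁻¹ S)
  obtain ⟨T, hT, hTJ⟩ := (Submodule.fg_span_iff_fg_span_finset_subset _).1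
    (IsNoetherian.noetherian J)
  have hcover : ∀ g : G, ∃ x ∈ T, E.ev g x ≠ 0 := by
    intro g
    by_contra! hcon
    have h3 : J ≤ RingHom.ker (E.ev g) := by
      change Submodule.span A (Set.range fun g : G => E.lTrans g⁻¹ S) ≤ _
      rw [hTJ]
      exact Submodule.span_le.2 fun x hx => RingHom.mem_ker.2 (hcon x hx)
    have h4 := RingHom.mem_ker.1 (h3 (Ideal.subset_span ⟨g, rfl⟩))
    rw [ev_lTrans, inv_mul_cancel, hS1] at h4
    exact one_ne_zero h4
  choose γ hγ using fun x : T => hT x.2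
  refine (Set.finite_range fun x : T => ρ (γ x) w).subset ?_
  rintro _ ⟨g, rfl⟩
  obtain ⟨x, hx, hgx⟩ := hcover g
  refine ⟨⟨x, hx⟩, ?_⟩
  have h5 : E.ev ((γ ⟨x, hx⟩)⁻¹ * g) S ≠ 0 := by
    have := hγ ⟨x, hx⟩
    rw [← ev_lTrans]
    simp only at this
    rwa [this]
  have h6 := hS _ h5
  have h7 := congrArg (ρ (γ ⟨x, hx⟩)) h6
  rw [← End.mul_apply, ← map_mul, mul_inv_cancel_left] at h7
  exact h7.symm

end FunctionAlgebra

end LocallyConstant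

/-! ### Trace forms, Casimir operators and linear reductivity -/

section LinearReductivity

universe u v w x

variable {k : Type u} {G : Type v} {A : Type w} [Field k] [Group G] [CommRing A] [Algebra k A]

/-- The restriction of a representation to a stable subspace. -/
def subRep {W : Type*} [AddCommGroup W] [Module k W] (ρ : Representation k G W)
    (M : Submodule k W) (hM : ∀ g, ∀ w ∈ M, ρ g w ∈ M) : Representation k G M where
  toFun g := (ρ g).restrict (hM g)
  map_one' := by ext; simp
  map_mul' g h := by ext; simp

lemma subRep_apply {W : Type*} [AddCommGroup W] [Module k W] (ρ : Representation k G W)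
    (M : Submodule k W) (hM : ∀ g, ∀ w ∈ M, ρ g w ∈ M) (g : G) (w : M) :
    (subRep ρ M hM g w : W) = ρ g w := rfl

namespace FunctionAlgebra

variable {E : FunctionAlgebra k G A}

lemma IsRational.subRep {W : Type*} [AddCommGroup W] [Module k W] {ρ : Representation k G W}
    (hρ : E.IsRational ρ) (M : Submodule k W) (hM : ∀ g, ∀ w ∈ M, ρ g w ∈ M) :
    E.IsRational (subRep ρ M hM) := by
  intro l x
  obtain ⟨l', hl'⟩ := l.exists_extend
  obtain ⟨f, hf⟩ := hρ l' x
  refine ⟨f, fun g => ?_⟩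
  rw [hf, ← hl']
  rfl

section TraceForm

variable {W : Type*} [AddCommGroup W] [Module k W] [FiniteDimensional k W]
  {ρ : Representation k G W}

/-- The trace form of a rational representation. -/
noncomputable def IsRational.traceForm (hρ : E.IsRational ρ) : LinearMap.BilinForm k E.lieAlg :=
  LinearMap.mk₂ k (fun x y => LinearMap.trace k W (hρ.dAct x * hρ.dAct y))
    (by intros; simp [add_mul]) (by intros; simp) (by intros; simp [mul_add]) (by intros; simp)

variable (hρ : E.IsRational ρ)

lemma IsRational.traceForm_apply (x y : E.lieAlg) :
    hρ.traceForm x y = LinearMap.trace k W (hρ.dAct x * hρ.dAct y) := rfl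

lemma IsRational.traceForm_comm (x y : E.lieAlg) : hρ.traceForm x y = hρ.traceForm y x :=
  LinearMap.trace_mul_comm k _ _

lemma IsRational.traceForm_isRefl : hρ.traceForm.IsRefl := fun x y h => by
  rw [hρ.traceForm_comm, h]

lemma IsRational.traceForm_lie (x y z : E.lieAlg) :
    hρ.traceForm ⁅x, y⁆ z = hρ.traceForm x ⁅y, z⁆ := by
  simp only [traceForm_apply, dAct_lie, sub_mul, mul_sub, map_sub]
  rw [mul_assoc (hρ.dAct y), LinearMap.trace_mul_comm k (hρ.dAct y), mul_assoc, mul_assoc]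

lemma IsRational.traceForm_Ad (g : G) (x y : E.lieAlg) :
    hρ.traceForm (E.Ad g x) (E.Ad g y) = hρ.traceForm x y := by
  simp only [traceForm_apply, dAct_Ad]
  have h : ρ g⁻¹ * ρ g = 1 := by rw [← map_mul, inv_mul_cancel, map_one]
  have h1 : ρ g * hρ.dAct x * ρ g⁻¹ * (ρ g * hρ.dAct y * ρ g⁻¹) =
      ρ g * (hρ.dAct x * hρ.dAct y * ρ g⁻¹) := by
    calc _ = ρ g * hρ.dAct x * (ρ g⁻¹ * ρ g) * (hρ.dAct y * ρ g⁻¹) := by simp only [mul_assoc]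
      _ = _ := by rw [h]; simp only [mul_assoc, mul_one]
  rw [h1, LinearMap.trace_mul_comm, mul_assoc, h, mul_one]

lemma IsRational.traceForm_Ad_left (g : G) (x y : E.lieAlg) :
    hρ.traceForm (E.Ad g x) y = hρ.traceForm x (E.Ad g⁻¹ y) := by
  conv_lhs => rw [← E.Ad_Ad_inv g y]
  rw [hρ.traceForm_Ad]

/-- The orthogonal of an ideal is an ideal. -/
lemma IsRational.lie_mem_orthogonal {a : Submodule k E.lieAlg} {x y : E.lieAlg}
    (hy : ∀ z ∈ a, ⁅y, z⁆ ∈ a) (hx : x ∈ hρ.traceForm.orthogonal a) :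
    ⁅x, y⁆ ∈ hρ.traceForm.orthogonal a := by
  rw [LinearMap.BilinForm.mem_orthogonal_iff] at *
  intro z hz
  have h : hρ.traceForm _ _ = 0 := hx _ (hy z hz)
  rw [hρ.traceForm_comm, hρ.traceForm_lie, hρ.traceForm_comm, h]

lemma IsRational.Ad_mem_orthogonal {a : Submodule k E.lieAlg} {x : E.lieAlg}
    (ha : ∀ g, ∀ z ∈ a, E.Ad g z ∈ a) (hx : x ∈ hρ.traceForm.orthogonal a) (g : G) :
    E.Ad g x ∈ hρ.traceForm.orthogonal a := by
  rw [LinearMap.BilinForm.mem_orthogonal_iff] at *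
  intro z hz
  have h : hρ.traceForm _ _ = 0 := hx _ (ha g⁻¹ z hz)
  rw [hρ.traceForm_comm, hρ.traceForm_Ad_left,
    hρ.traceForm_comm, h]

/-- The Casimir operator of a stable subspace on which the trace form is nondegenerate. -/
lemma exists_casimir (b : Submodule k E.lieAlg) [FiniteDimensional k b]
    (hb : ∀ g, ∀ x ∈ b, E.Ad g x ∈ b) (hnd : (hρ.traceForm.restrict b).Nondegenerate) :
    ∃ C : End k W, LinearMap.trace k W C = finrank k b ∧ (∀ g, ρ g * C = C * ρ g) ∧
      ∀ l : Dual k W, (∀ g w, l (ρ g w) = l w) → ∀ w, l (C w) = 0 := by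
  classical
  set β := hρ.traceForm.restrict b with hβ
  have hβs : β.IsSymm := ⟨fun x y => hρ.traceForm_comm _ _⟩
  let e := Module.finBasis k b
  let e' := β.dualBasis hnd e
  have hexp : ∀ x : b, x = ∑ i, β x (e i) • e' i := by
    intro x
    conv_lhs => rw [← e'.sum_repr x]
    simp [e']
  have hexp' : ∀ x : b, x = ∑ i, β (e' i) x • e i := by
    intro x
    conv_lhs => rw [← e.sum_repr x]
    refine Finset.sum_congr rfl fun i _ => ?_
    congr 1
    conv_rhs => rw [← e.sum_repr x]
    rw [map_sum]
    simp [e', LinearMap.BilinForm.apply_dualBasis_left]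
  refine ⟨∑ i, hρ.dAct (e i) * hρ.dAct (e' i), ?_, fun g => ?_, fun l hl w => ?_⟩
  · rw [map_sum]
    have : ∀ i, LinearMap.trace k W (hρ.dAct (e i) * hρ.dAct (e' i)) = 1 := fun i => by
      have h := LinearMap.BilinForm.apply_dualBasis_right hnd hβs e i i
      rw [if_pos rfl] at h
      exact h
    simp [this]
  · let T : b → b := fun x => ⟨E.Ad g x, hb g x x.2⟩
    let T' : b → b := fun x => ⟨E.Ad g⁻¹ x, hb g⁻¹ x x.2⟩
    have hTT' : ∀ x, T (T' x) = x := fun x => Subtype.ext (E.Ad_Ad_inv g x)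
    have hβT : ∀ x y, β (T x) y = β x (T' y) := fun x y => hρ.traceForm_Ad_left g _ _
    have hβT' : ∀ x y, β x (T y) = β (T' x) y := fun x y => by
      rw [hβs.eq x, hβT, hβs.eq]
    -- Independence of the Casimir sum from the dual bases: `T (e i)` in the basis `e` and `e' j` in
    -- terms of the `T (e' i)` have the same coefficient matrix.
    have key : ∑ i, hρ.dAct (T (e i)) * hρ.dAct (T (e' i)) =
        ∑ i, hρ.dAct (e i) * hρ.dAct (e' i) := by
      have h1 : ∀ i, hρ.dAct (T (e i)) = ∑ j, β (e' j) (T (e i)) • hρ.dAct (e j) := fun i => by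
        conv_lhs => rw [hexp' (T (e i))]
        simp
      have h2 : ∀ j, hρ.dAct (e' j) = ∑ i, β (e' j) (T (e i)) • hρ.dAct (T (e' i)) := fun j => by
        conv_lhs => rw [← hTT' (e' j), hexp (T' (e' j))]
        simp [T, hβT']
      calc _ = ∑ i, ∑ j, β (e' j) (T (e i)) • (hρ.dAct (e j) * hρ.dAct (T (e' i))) := by
            refine Finset.sum_congr rfl fun i _ => ?_
            rw [h1, Finset.sum_mul]
            simp only [smul_mul_assoc]
        _ = _ := by
            rw [Finset.sum_comm]
            refine Finset.sum_congr rfl fun j _ => ?_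
            rw [h2 j, Finset.mul_sum]
            simp only [mul_smul_comm]
    have hg : ρ g⁻¹ * ρ g = 1 := by rw [← map_mul, inv_mul_cancel, map_one]
    conv_rhs => rw [← key]
    rw [Finset.mul_sum, Finset.sum_mul]
    refine Finset.sum_congr rfl fun i _ => ?_
    simp only [T, hρ.dAct_Ad]
    calc _ = ρ g * hρ.dAct (e i) * 1 * hρ.dAct (e' i) * 1 := by simp only [mul_assoc, mul_one]
      _ = _ := by rw [← hg]; simp only [mul_assoc]
  · simp only [LinearMap.sum_apply, map_sum, End.mul_apply, hρ.dAct_of_invariant _ l hl,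
      Finset.sum_const_zero]

end TraceForm

/-- Linear reductivity: if every stable subalgebra of left invariant derivations which acts
nilpotently on some fixed representation vanishes, then invariant functionals on rational
representations detect invariant vectors. -/
theorem exists_invariant [IsAlgClosed k] [CharZero k] [Algebra.FiniteType k A]
    {V : Type*} [AddCommGroup V] [Module k V] [FiniteDimensional k V] {σ : Representation k G V}
    (hσ : E.IsRational σ)
    (key : ∀ r : Submodule k E.lieAlg, (∀ x ∈ r, ∀ y ∈ r, ⁅x, y⁆ ∈ r) →
      (∀ g, ∀ x ∈ r, E.Ad g x ∈ r) → (∀ x ∈ r, IsNilpotent (hσ.dAct x)) → r = ⊥)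
    (n : ℕ) : ∀ {W : Type x} [AddCommGroup W] [Module k W] [FiniteDimensional k W]
    {ρ : Representation k G W} (_ : E.IsRational ρ) (_ : finrank k W = n) (ε : Dual k W)
    (_ : ∀ g w, ε (ρ g w) = ε w) (_ : ε ≠ 0), ∃ w, (∀ g, ρ g w = w) ∧ ε w = 1 := by
  induction n using Nat.strong_induction_on with
  | _ n ih =>
  intro W _ _ _ ρ hρ hn ε hε hε0
  -- The kernel acts by zero, hence nilpotently, so `key` applies. The Lie algebra thus embeds in
  -- `End V` and is finite-dimensional.
  have hinj : Function.Injective hσ.dAct := by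
    rw [← LinearMap.ker_eq_bot]
    refine key _ (fun x hx y hy => ?_) (fun g x hx => ?_) (fun x hx => ?_)
    · rw [LinearMap.mem_ker] at *
      rw [hσ.dAct_lie, hx, zero_mul, mul_zero, sub_zero]
    · rw [LinearMap.mem_ker] at *
      rw [hσ.dAct_Ad, hx, mul_zero, zero_mul]
    · rw [LinearMap.mem_ker.1 hx]; exact IsNilpotent.zero
  have hfd : FiniteDimensional k E.lieAlg := FiniteDimensional.of_injective _ hinj
  let a : Submodule k E.lieAlg := LinearMap.ker hρ.dAct
  have ha : ∀ {z}, z ∈ a ↔ hρ.dAct z = 0 := LinearMap.mem_ker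
  have ha_lie : ∀ y, ∀ z ∈ a, ⁅y, z⁆ ∈ a := fun y z hz => by
    rw [ha] at *
    rw [hρ.dAct_lie, hz, zero_mul, mul_zero, sub_zero]
  have ha_Ad : ∀ g, ∀ z ∈ a, E.Ad g z ∈ a := fun g z hz => by
    rw [ha] at *
    rw [hρ.dAct_Ad, hz, mul_zero, zero_mul]
  set b : Submodule k E.lieAlg := hσ.traceForm.orthogonal a with hb
  have hb_lie : ∀ x, ∀ y ∈ b, ⁅x, y⁆ ∈ b := fun x y hy => by
    rw [← lie_skew]
    exact neg_mem (hσ.lie_mem_orthogonal (ha_lie x) hy)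
  have hb_Ad : ∀ g, ∀ z ∈ b, E.Ad g z ∈ b := fun g z hz => hσ.Ad_mem_orthogonal ha_Ad hz g
  -- If `x` is nilpotent on `W`, its replicas act by zero on `W`, so they lie in `a` and are
  -- orthogonal to `x ∈ b` for the trace form of `V`. The criterion then makes `x` nilpotent on `V`.
  have hnilp : ∀ x ∈ b, IsNilpotent (hρ.dAct x) → IsNilpotent (hσ.dAct x) := by
    intro x hx hnil
    refine isNilpotent_dAct_of_trace hσ x fun D' φ hD' => ?_
    exact hx D' (ha.2 (hD'.dAct_eq_zero hρ hnil))
  have hdisj : Disjoint a b := by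
    rw [disjoint_iff]
    refine key _ (fun x hx y hy => ⟨ha_lie x y hy.1, hb_lie x y hy.2⟩)
      (fun g x hx => ⟨ha_Ad g x hx.1, hb_Ad g x hx.2⟩) (fun x hx => hnilp x hx.2 ?_)
    rw [ha.1 hx.1]; exact IsNilpotent.zero
  have hcompl : IsCompl a b :=
    (LinearMap.BilinForm.isCompl_orthogonal_iff_disjoint hσ.traceForm_isRefl).2 hdisj
  -- If `b = 0`, the whole Lie algebra kills `W`; any vector with `ε w = 1` has a finite orbit, and
  -- its average is the required invariant.
  by_cases hb0 : b = ⊥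
  · have hatop : a = ⊤ := by
      have := hcompl.sup_eq_top
      rwa [hb0, sup_bot_eq] at this
    have hzero : ∀ D, hρ.dAct D = 0 := fun D => ha.1 (hatop.ge Submodule.mem_top)
    obtain ⟨w, hw⟩ : ∃ w, ε w = 1 := by
      obtain ⟨w, hw⟩ : ∃ w, ε w ≠ 0 := by
        by_contra! hcon
        exact hε0 (LinearMap.ext hcon)
      exact ⟨(ε w)⁻¹ • w, by simp [hw]⟩
    have hfin := finite_orbit hρ w (fun D => by rw [hzero]; rfl)
    set S := hfin.toFinset with hS
    have hcard : (S.card : k) ≠ 0 := by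
      rw [Nat.cast_ne_zero]
      exact Finset.card_ne_zero.2 ⟨w, by rw [hS, Set.Finite.mem_toFinset]; exact ⟨1, by simp⟩⟩
    have hstab : ∀ g, ∀ y ∈ S, ρ g y ∈ S := by
      intro g y hy
      rw [hS, Set.Finite.mem_toFinset] at *
      obtain ⟨h, rfl⟩ := hy
      exact ⟨g * h, by simp⟩
    have hcancel : ∀ g y, ρ g (ρ g⁻¹ y) = y := fun g y => by
      rw [← End.mul_apply, ← map_mul, mul_inv_cancel, map_one, End.one_apply]
    refine ⟨(S.card : k)⁻¹ • ∑ y ∈ S, y, fun g => ?_, ?_⟩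
    · rw [map_smul, map_sum]
      congr 1
      refine Finset.sum_bij (fun y _ => ρ g y) (hstab g) ?_ ?_ (fun _ _ => rfl)
      · intro y _ z _ h
        have := congrArg (ρ g⁻¹) h
        simpa [← End.mul_apply, ← map_mul] using this
      · exact fun y hy => ⟨ρ g⁻¹ y, hstab _ _ hy, hcancel g y⟩
    · rw [map_smul, map_sum]
      have : ∀ y ∈ S, ε y = 1 := by
        intro y hy
        rw [hS, Set.Finite.mem_toFinset] at hy
        obtain ⟨h, rfl⟩ := hy
        rw [hε, hw]
      rw [Finset.sum_congr rfl this]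
      simp [hcard]
  -- The radical on `b` of the trace form of `W` vanishes. A replica of a radical element `x` splits
  -- along `a ⊕ b`: its `a`-part acts by zero on `W` and its `b`-part is orthogonal to `x`. So `x`
  -- is nilpotent on `W`, hence on `V`.
  · have hr : b ⊓ hρ.traceForm.orthogonal b = ⊥ := by
      refine key _ (fun x hx y hy => ⟨hb_lie x y hy.1,
        hρ.lie_mem_orthogonal (fun z hz => hb_lie y z hz) hx.2⟩)
        (fun g x hx => ⟨hb_Ad g x hx.1, hρ.Ad_mem_orthogonal hb_Ad hx.2 g⟩)
        (fun x hx => hnilp x hx.1 (isNilpotent_dAct_of_trace hρ x fun D' φ hD' => ?_))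
      obtain ⟨s, hs, t, ht, rfl⟩ : ∃ s ∈ a, ∃ t ∈ b, s + t = D' :=
        Submodule.mem_sup.1 (hcompl.sup_eq_top.ge Submodule.mem_top)
      rw [map_add, ha.1 hs, zero_add]
      exact hx.2 t ht
    have hnd : (hρ.traceForm.restrict b).Nondegenerate :=
      LinearMap.BilinForm.nondegenerate_restrict_of_disjoint_orthogonal _ hρ.traceForm_isRefl
        (disjoint_iff.2 hr)
    obtain ⟨C, hCtr, hCcomm, hCε⟩ := exists_casimir hρ b hb_Ad hnd
    -- Fitting decomposition for the Casimir operator. Since `ε ∘ C = 0` and `N ≥ 1`, `ε` lives on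
    -- `ker (C ^ N)`; this stable subspace is proper because `C` has trace `dim b ≠ 0` and so is not
    -- nilpotent. The induction applies to it.
    obtain ⟨N, hN, hN0⟩ := ((LinearMap.eventually_isCompl_ker_pow_range_pow C).and
      (Filter.eventually_ge_atTop 1)).exists
    have hpow : ∀ g, ρ g * C ^ N = C ^ N * ρ g := fun g => (Commute.pow_right (hCcomm g) N)
    have hM : ∀ g, ∀ w ∈ LinearMap.ker (C ^ N), ρ g w ∈ LinearMap.ker (C ^ N) := by
      intro g w hw
      rw [LinearMap.mem_ker] at *
      rw [← End.mul_apply, ← hpow, End.mul_apply, hw, map_zero]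
    have hεr : ∀ w ∈ LinearMap.range (C ^ N), ε w = 0 := by
      rintro _ ⟨w, rfl⟩
      obtain ⟨m, rfl⟩ : ∃ m, N = m + 1 := ⟨N - 1, by omega⟩
      rw [pow_succ', End.mul_apply]
      exact hCε ε hε _
    have hlt : finrank k (LinearMap.ker (C ^ N)) < n := by
      rw [← hn]
      refine Submodule.finrank_lt fun htop => ?_
      have hnil : IsNilpotent C := ⟨N, LinearMap.ker_eq_top.1 htop⟩
      have h0 := (LinearMap.isNilpotent_trace_of_isNilpotent hnil).eq_zero
      rw [hCtr, Nat.cast_eq_zero] at h0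
      exact hb0 (Submodule.finrank_eq_zero.1 h0)
    obtain ⟨w, hw, hw1⟩ := ih _ hlt (hρ.subRep _ hM) rfl (ε ∘ₗ Submodule.subtype _)
      (fun g w => hε g w) (fun h0 => hε0 <| by
        ext w
        obtain ⟨s, hs, t, ht, rfl⟩ : ∃ s ∈ LinearMap.ker (C ^ N),
            ∃ t ∈ LinearMap.range (C ^ N), s + t = w :=
          Submodule.mem_sup.1 (hN.sup_eq_top.ge Submodule.mem_top)
        have := LinearMap.congr_fun h0 ⟨s, hs⟩
        rw [map_add, hεr t ht, add_zero]
        exact this)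
    exact ⟨w, fun g => congrArg Subtype.val (hw g), hw1⟩

/-- The conclusion of `exists_invariant`, as a property of the group. -/
def LinearlyReductive (E : FunctionAlgebra k G A) : Prop :=
  ∀ {W : Type x} [AddCommGroup W] [Module k W] [FiniteDimensional k W]
    {ρ : Representation k G W} (_ : E.IsRational ρ) (ε : Dual k W)
    (_ : ∀ g w, ε (ρ g w) = ε w) (_ : ε ≠ 0), ∃ w, (∀ g, ρ g w = w) ∧ ε w = 1

/-- A stable affine subspace of a rational representation contains a fixed point. -/
theorem LinearlyReductive.exists_fixed_point (hE : LinearlyReductive.{u, v, w, x} E)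
    {W : Type x} [AddCommGroup W] [Module k W] [FiniteDimensional k W]
    {ρ : Representation k G W} (hρ : E.IsRational ρ) (Q : Submodule k W)
    (hQ : ∀ g, ∀ q ∈ Q, ρ g q ∈ Q) (w : W) (hw : ∀ g, ρ g w - w ∈ Q) :
    ∃ q ∈ Q, ∀ g, ρ g (w + q) = w + q := by
  by_cases hwQ : w ∈ Q
  · exact ⟨-w, neg_mem hwQ, fun g => by simp⟩
  obtain ⟨l, hlw, hlQ⟩ := Submodule.exists_le_ker_of_notMem hwQ
  set M : Submodule k W := Submodule.span k {w} ⊔ Q with hM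
  have hwM : w ∈ M := Submodule.mem_sup_left (Submodule.mem_span_singleton_self w)
  have hQM : Q ≤ M := le_sup_right
  have hMdec : ∀ y ∈ M, ∃ c : k, ∃ q ∈ Q, y = c • w + q := by
    intro y hy
    obtain ⟨s, hs, t, ht, rfl⟩ := Submodule.mem_sup.1 hy
    obtain ⟨c, rfl⟩ := Submodule.mem_span_singleton.1 hs
    exact ⟨c, t, ht, rfl⟩
  have hρM : ∀ g, ∀ y ∈ M, ρ g y - y ∈ Q := by
    intro g y hy
    obtain ⟨c, q, hq, rfl⟩ := hMdec y hy
    have : ρ g (c • w + q) - (c • w + q) = c • (ρ g w - w) + (ρ g q - q) := by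
      rw [map_add, map_smul]; module
    rw [this]
    exact add_mem (Submodule.smul_mem _ _ (hw g)) (sub_mem (hQ g q hq) hq)
  have hMs : ∀ g, ∀ y ∈ M, ρ g y ∈ M := fun g y hy => by
    have := add_mem (hQM (hρM g y hy)) hy
    simpa using this
  -- The group acts trivially on `M / Q`, so `l`, which vanishes on `Q`, is invariant on `M`.
  -- Scaling it to be `1` at `w` places the invariant vector in `w + Q`.
  obtain ⟨y, hy, hy1⟩ := hE (hρ.subRep M hMs) ((l w)⁻¹ • (l ∘ₗ M.subtype))
    (fun g y => by
      have : l (ρ g y - y) = 0 := hlQ (hρM g y y.2)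
      rw [map_sub, sub_eq_zero] at this
      simp [subRep_apply, this])
    (fun h0 => by
      have := LinearMap.congr_fun h0 ⟨w, hwM⟩
      simp [hlw] at this)
  obtain ⟨c, q, hq, hyq⟩ := hMdec y y.2
  have hlq : l q = 0 := hlQ hq
  have hc : c = 1 := by
    simp only [LinearMap.smul_apply, LinearMap.comp_apply, Submodule.subtype_apply, hyq, map_add,
      map_smul, hlq, add_zero, smul_eq_mul] at hy1
    field_simp at hy1
    exact hy1
  rw [hc, one_smul] at hyq
  refine ⟨q, hq, fun g => ?_⟩
  rw [← hyq]
  exact congrArg Subtype.val (hy g)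

end FunctionAlgebra

end LinearReductivity

/-! ### Engel's theorem and operators shifting a flag -/

section Flags

variable {k V L : Type*} [Field k] [AddCommGroup V] [Module k V] [LieRing L] [LieAlgebra k L]

/-- The descending flag `V, L V, L (L V), …`. -/
def flag (f : L →ₗ[k] End k V) : ℕ → Submodule k V
  | 0 => ⊤
  | i + 1 => Submodule.span k {w | ∃ x, ∃ v ∈ flag f i, f x v = w}

lemma apply_mem_flag (f : L →ₗ[k] End k V) (x : L) {i : ℕ} {v : V} (hv : v ∈ flag f i) :
    f x v ∈ flag f (i + 1) := Submodule.subset_span ⟨x, v, hv, rfl⟩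

/-- Engel's theorem. -/
lemma exists_flag_eq_bot [FiniteDimensional k V] (f : L →ₗ[k] End k V)
    (hf : ∀ x y, f ⁅x, y⁆ = f x * f y - f y * f x) (hnil : ∀ x, IsNilpotent (f x)) :
    ∃ N, flag f N = ⊥ := by
  let _ : LieRingModule L V :=
    { bracket := fun x v => f x v
      add_lie := fun x y v => by simp
      lie_add := fun x v w => map_add (f x) v w
      leibniz_lie := fun x y v => by change f x (f y v) = f ⁅x, y⁆ v + f y (f x v); simp [hf] }
  have hbr : ∀ (x : L) (v : V), ⁅x, v⁆ = f x v := fun _ _ => rfl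
  let _ : LieModule k L V :=
    { smul_lie := fun t x v => by simp [hbr]
      lie_smul := fun t x v => by simp [hbr] }
  have hE : LieModule.IsNilpotent L V := by
    rw [LieModule.isNilpotent_iff_forall' (R := k)]
    intro x
    have : LieModule.toEnd k L V x = f x := LinearMap.ext fun v => rfl
    rw [this]
    exact hnil x
  obtain ⟨N, hN⟩ := LieModule.IsNilpotent.nilpotent k L V
  refine ⟨N, ?_⟩
  -- Engel's theorem makes the lower central series of the module reach zero, and it dominates the
  -- flag.
  have hle : ∀ i, flag f i ≤ (LieModule.lowerCentralSeries k L V i).toSubmodule := by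
    intro i
    induction i with
    | zero => simp
    | succ i ih =>
      refine Submodule.span_le.2 ?_
      rintro _ ⟨x, v, hv, rfl⟩
      rw [LieModule.lowerCentralSeries_succ]
      exact LieSubmodule.lie_mem_lie (LieSubmodule.mem_top x) (ih hv)
  rw [eq_bot_iff]
  refine (hle N).trans ?_
  rw [hN]
  simp

/-- Meant for `T` the action of a group element and `S` its adjoint action: the flag of a stable Lie
algebra is stable under the group. -/
lemma map_flag_le (f : L →ₗ[k] End k V) (T : V →ₗ[k] V) (S : L → L)
    (hT : ∀ x v, T (f x v) = f (S x) (T v)) (i : ℕ) : ∀ v ∈ flag f i, T v ∈ flag f i := by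
  induction i with
  | zero => intro v _; trivial
  | succ i ih =>
    intro v hv
    have : flag f (i + 1) ≤ (flag f (i + 1)).comap T := by
      refine Submodule.span_le.2 ?_
      rintro _ ⟨x, v, hv, rfl⟩
      rw [SetLike.mem_coe, Submodule.mem_comap, hT]
      exact apply_mem_flag f _ (ih v hv)
    exact this hv

/-- The operators which shift a filtration by one step. -/
def shiftOps (F : ℕ → Submodule k V) : Submodule k (End k V) where
  carrier := {a | ∀ i, ∀ v ∈ F i, a v ∈ F (i + 1)}
  add_mem' ha hb i v hv := add_mem (ha i v hv) (hb i v hv)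
  zero_mem' _ _ _ := zero_mem _
  smul_mem' c _ ha i v hv := Submodule.smul_mem _ c (ha i v hv)

lemma pow_apply_mem_of_mem_shiftOps {F : ℕ → Submodule k V} {a : End k V} (ha : a ∈ shiftOps F)
    (N : ℕ) : ∀ i, ∀ v ∈ F i, (a ^ N) v ∈ F (i + N) := by
  induction N with
  | zero => intro i v hv; simpa using hv
  | succ N ih =>
    intro i v hv
    rw [pow_succ, End.mul_apply, show i + (N + 1) = (i + 1) + N by ring]
    exact ih _ _ (ha i v hv)

lemma pow_eq_zero_of_mem_shiftOps {F : ℕ → Submodule k V} {N : ℕ} (h0 : F 0 = ⊤) (hN : F N = ⊥)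
    {a : End k V} (ha : a ∈ shiftOps F) : a ^ N = 0 := by
  ext v
  have := pow_apply_mem_of_mem_shiftOps ha N 0 v (h0 ▸ Submodule.mem_top)
  rwa [zero_add, hN, Submodule.mem_bot] at this

/-- For a decreasing filtration, products of shifting operators are shifting. -/
lemma mul_mem_shiftOps {F : ℕ → Submodule k V} {a b : End k V}
    (ha : ∀ i, ∀ v ∈ F i, a v ∈ F i) (hb : b ∈ shiftOps F) : a * b ∈ shiftOps F :=
  fun i v hv => ha _ _ (hb i v hv)

end Flags

/-! ### The polynomial path `t ↦ (1 + x) ^ t` for nilpotent `x` -/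

section PowPath

variable {k R : Type*} [Field k] [Ring R] [Algebra k R]

/-- The binomial coefficient `t (t - 1) ⋯ (t - m + 1) / m!` as a polynomial in `t`. -/
noncomputable def binomPoly (k : Type*) [Field k] (m : ℕ) : Polynomial k :=
  Polynomial.C ((m.factorial : k)⁻¹) * descPochhammer k m

lemma eval_natCast_binomPoly [CharZero k] (m j : ℕ) :
    (binomPoly k m).eval (j : k) = (j.choose m : k) := by
  rw [binomPoly, Polynomial.eval_mul, Polynomial.eval_C, descPochhammer_eval_eq_descFactorial,
    Nat.descFactorial_eq_factorial_mul_choose]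
  push_cast
  rw [inv_mul_cancel_left₀ (by exact_mod_cast m.factorial_ne_zero)]

/-- The binomial series `(1 + x) ^ t`, truncated at `K`. -/
noncomputable def powPath (x : R) (K : ℕ) (t : k) : R :=
  ∑ m ∈ Finset.range K, (binomPoly k m).eval t • x ^ m

/-- Enlarging the truncation to contain the whole binomial expansion adds only zero terms.
Polynomial identities along the path can hence be checked on honest powers. -/
lemma powPath_natCast [CharZero k] (x : R) (K : ℕ) (hx : x ^ K = 0) (j : ℕ) :
    powPath x K (j : k) = (1 + x) ^ j := by
  have h1 : ∀ K', K ≤ K' → powPath x K' (j : k) = powPath x K (j : k) := by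
    intro K' hK
    refine (Finset.sum_subset (Finset.range_mono hK) fun m _ hm => ?_).symm
    rw [Finset.mem_range, not_lt] at hm
    rw [pow_eq_zero_of_le hm hx, smul_zero]
  have h2 : powPath x (max K (j + 1)) (j : k) = (1 + x) ^ j := by
    rw [add_comm 1 x, (Commute.one_right x).add_pow]
    symm
    simp only [powPath, eval_natCast_binomPoly]
    rw [← Finset.sum_subset (Finset.range_mono (le_max_right K (j + 1)))]
    · refine Finset.sum_congr rfl fun m _ => ?_
      rw [one_pow, mul_one, Algebra.smul_def, map_natCast]
      exact (Nat.cast_commute _ _).symm.eq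
    · intro m _ hm
      rw [Finset.mem_range, not_lt] at hm
      rw [Nat.choose_eq_zero_of_lt (by omega), Nat.cast_zero, zero_smul]
  rw [← h1 _ (le_max_left _ _), h2]

lemma powPath_succ_sub_one (x : R) (K : ℕ) (t : k) :
    powPath x (K + 1) t - 1 =
      x * ∑ m ∈ Finset.range K, (binomPoly k (m + 1)).eval t • x ^ m := by
  rw [powPath, Finset.sum_range_succ', Finset.mul_sum]
  simp [binomPoly, pow_succ']

/-- A truncation at `K + 1` always retains the constant term `1`, so the path is `1` plus a
nilpotent. -/
lemma isUnit_powPath_succ (x : R) (hx : IsNilpotent x) (K : ℕ) (t : k) :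
    IsUnit (powPath x (K + 1) t) := by
  have h1 : IsNilpotent (powPath x (K + 1) t - 1) := by
    rw [powPath_succ_sub_one]
    refine Commute.isNilpotent_mul_right ?_ hx
    exact Commute.sum_right _ _ _ fun m _ => (Commute.pow_right rfl m).smul_right _
  simpa using h1.isUnit_add_one

/-- A polynomial which vanishes at all natural numbers vanishes. -/
lemma polynomial_eq_zero_of_natCast [CharZero k] (p : Polynomial k)
    (h : ∀ j : ℕ, p.eval (j : k) = 0) : p = 0 :=
  Polynomial.eq_zero_of_infinite_isRoot p <|
    (Set.infinite_range_of_injective Nat.cast_injective).mono (by rintro _ ⟨j, rfl⟩; exact h j)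

end PowPath

/-! ### Taylor series along a derivation -/

section FormalExp

variable {k G A : Type*} [Field k] [CharZero k] [CommRing A] [Algebra k A]

/-- The Taylor series at a point `e` along a derivation. -/
noncomputable def taylorLin (e : A →ₐ[k] k) (D : Derivation k A A) : A →ₗ[k] PowerSeries k where
  toFun f := PowerSeries.mk fun m => (m.factorial : k)⁻¹ * e (((D : A →ₗ[k] A) ^ m) f)
  map_add' f f' := by ext m; simp [mul_add]
  map_smul' c f := by ext m; simp; ring

lemma coeff_taylorLin (e : A →ₐ[k] k) (D : Derivation k A A) (f : A) (m : ℕ) :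
    PowerSeries.coeff m (taylorLin e D f) =
      (m.factorial : k)⁻¹ * e (((D : A →ₗ[k] A) ^ m) f) := by
  simp [taylorLin]

lemma derivative_taylorLin (e : A →ₐ[k] k) (D : Derivation k A A) (f : A) :
    PowerSeries.derivative k (taylorLin e D f) = taylorLin e D (D f) := by
  ext m
  rw [PowerSeries.coeff_derivative, coeff_taylorLin, coeff_taylorLin, Nat.factorial_succ, pow_succ,
    End.mul_apply, Derivation.coeFn_coe]
  have : (m.factorial : k) ≠ 0 := by exact_mod_cast m.factorial_ne_zero
  have : ((m : k) + 1) ≠ 0 := by exact_mod_cast m.succ_ne_zero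
  push_cast
  field_simp

/-- Induction on the coefficient after differentiating: both sides obey the same Leibniz rule and
have the same constant term. -/
lemma taylorLin_mul (e : A →ₐ[k] k) (D : Derivation k A A) (f f' : A) :
    taylorLin e D (f * f') = taylorLin e D f * taylorLin e D f' := by
  ext m
  induction m generalizing f f' with
  | zero => simp [taylorLin]
  | succ m ih =>
    have h0 : ((m : k) + 1) ≠ 0 := by exact_mod_cast m.succ_ne_zero
    refine mul_right_cancel₀ h0 ?_
    rw [← PowerSeries.coeff_derivative, ← PowerSeries.coeff_derivative, derivative_taylorLin,
      Derivation.leibniz, Derivation.leibniz, derivative_taylorLin, derivative_taylorLin]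
    simp only [smul_eq_mul, map_add, ih]

/-- The Taylor series at a point along a derivation, as a homomorphism of algebras. -/
noncomputable def taylor (e : A →ₐ[k] k) (D : Derivation k A A) : A →ₐ[k] PowerSeries k :=
  AlgHom.ofLinearMap (taylorLin e D) (by
    ext m
    rw [coeff_taylorLin]
    rcases m with _ | m
    · simp
    · rw [pow_succ, End.mul_apply]; simp [PowerSeries.coeff_one]) (taylorLin_mul e D)

lemma coeff_taylor (e : A →ₐ[k] k) (D : Derivation k A A) (f : A) (m : ℕ) :
    PowerSeries.coeff m (taylor e D f) = (m.factorial : k)⁻¹ * e (((D : A →ₗ[k] A) ^ m) f) :=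
  coeff_taylorLin e D f m

end FormalExp

/-! ### The coordinate ring of a linear group and its standard representation -/

section CoordinateRing

variable {k : Type*} [Field k] {n : ℕ}

/-- The entries of `g` and of `g⁻¹`. -/
def entries (g : GL (Fin n) k) : (Fin n × Fin n) ⊕ (Fin n × Fin n) → k :=
  Sum.elim (fun ij => (g : Matrix (Fin n) (Fin n) k) ij.1 ij.2)
    (fun ij => ((g⁻¹ : GL (Fin n) k) : Matrix (Fin n) (Fin n) k) ij.1 ij.2)

variable (G : Subgroup (GL (Fin n) k))

/-- Polynomials in the entries of `g` and of `g⁻¹` as functions on `G`. -/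
noncomputable def entryHom :
    MvPolynomial ((Fin n × Fin n) ⊕ (Fin n × Fin n)) k →ₐ[k] (G → k) :=
  AlgHom.pi fun g : G => MvPolynomial.aeval (entries (g : GL (Fin n) k))

/-- The ring of regular functions on `G`. -/
def CoordRing : Type _ := (entryHom G).range

noncomputable instance : CommRing (CoordRing G) := inferInstanceAs (CommRing (entryHom G).range)

noncomputable instance : Algebra k (CoordRing G) :=
  inferInstanceAs (Algebra k (entryHom G).range)

/-- The regular function given by a polynomial. -/
noncomputable def toCoordRing :
    MvPolynomial ((Fin n × Fin n) ⊕ (Fin n × Fin n)) k →ₐ[k] CoordRing G :=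
  (entryHom G).rangeRestrict

lemma toCoordRing_surjective : Function.Surjective (toCoordRing G) :=
  (entryHom G).rangeRestrict_surjective

instance : Algebra.FiniteType k (CoordRing G) :=
  Algebra.FiniteType.of_surjective (toCoordRing G) (toCoordRing_surjective G)

/-- Evaluation of regular functions. -/
noncomputable def coordEval (g : G) : CoordRing G →ₐ[k] k :=
  (Pi.evalAlgHom k (fun _ : G => k) g).comp (entryHom G).range.val

variable {G}

lemma coordEval_toCoordRing (g : G) (p : MvPolynomial ((Fin n × Fin n) ⊕ (Fin n × Fin n)) k) :
    coordEval G g (toCoordRing G p) = MvPolynomial.eval (entries (g : GL (Fin n) k)) p := by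
  change MvPolynomial.aeval _ p = _
  rw [MvPolynomial.aeval_eq_eval]

lemma coordRing_ext {f f' : CoordRing G} (h : ∀ g, coordEval G g f = coordEval G g f') : f = f' :=
  Subtype.ext (funext h)

lemma coordRing_exists_comul (f : CoordRing G) :
    ∃ (ι : Type) (_ : Fintype ι) (p q : ι → CoordRing G),
    ∀ h g : G, coordEval G (h * g) f = ∑ i, coordEval G h (p i) * coordEval G g (q i) := by
  obtain ⟨P, rfl⟩ := toCoordRing_surjective G f
  induction P using MvPolynomial.induction_on with
  | C c =>
    exact ⟨Unit, inferInstance, fun _ => toCoordRing G (MvPolynomial.C c), fun _ => 1, fun h g => by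
      simp⟩
  | add P Q hP hQ =>
    obtain ⟨ι, _, p, q, H⟩ := hP
    obtain ⟨ι', _, p', q', H'⟩ := hQ
    exact ⟨ι ⊕ ι', inferInstance, Sum.elim p p', Sum.elim q q', fun h g => by simp [H, H']⟩
  | mul_X P i hP =>
    obtain ⟨ι, _, p, q, H⟩ := hP
    obtain ⟨p', q', H'⟩ : ∃ p' q' : Fin n → CoordRing G, ∀ h g : G,
        coordEval G (h * g) (toCoordRing G (MvPolynomial.X i)) =
          ∑ l, coordEval G h (p' l) * coordEval G g (q' l) := by
      rcases i with ij | ij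
      · refine ⟨fun l => toCoordRing G (MvPolynomial.X (Sum.inl (ij.1, l))),
          fun l => toCoordRing G (MvPolynomial.X (Sum.inl (l, ij.2))), fun h g => ?_⟩
        simp [coordEval_toCoordRing, entries, Matrix.mul_apply]
      -- Inversion reverses products, so the row and column indices trade places between the two
      -- factors.
      · refine ⟨fun l => toCoordRing G (MvPolynomial.X (Sum.inr (l, ij.2))),
          fun l => toCoordRing G (MvPolynomial.X (Sum.inr (ij.1, l))), fun h g => ?_⟩
        simp only [coordEval_toCoordRing, MvPolynomial.eval_X, entries, Sum.elim_inr,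
          Subgroup.coe_mul, mul_inv_rev, Units.val_mul, Matrix.mul_apply]
        exact Finset.sum_congr rfl fun l _ => mul_comm _ _
    refine ⟨ι × Fin n, inferInstance, fun x => p x.1 * p' x.2, fun x => q x.1 * q' x.2,
      fun h g => ?_⟩
    rw [map_mul, map_mul, H, H', Finset.sum_mul_sum, Fintype.sum_prod_type]
    refine Finset.sum_congr rfl fun a _ => Finset.sum_congr rfl fun b _ => ?_
    rw [map_mul, map_mul]; ring

variable (G) in
/-- The ring of regular functions on `G` as an algebra of functions. -/
noncomputable def coordAlg : FunctionAlgebra k G (CoordRing G) where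
  ev := coordEval G
  ext_ev := coordRing_ext
  exists_comul := coordRing_exists_comul

lemma coordAlg_ev (g : G) (p : MvPolynomial ((Fin n × Fin n) ⊕ (Fin n × Fin n)) k) :
    (coordAlg G).ev g (toCoordRing G p) = MvPolynomial.eval (entries (g : GL (Fin n) k)) p :=
  coordEval_toCoordRing g p

lemma isRegularFun_iff (f : G → k) :
    IsRegularFun f ↔ ∃ a : CoordRing G, ∀ g, (coordAlg G).ev g a = f g := by
  constructor
  · rintro ⟨p, hp⟩
    exact ⟨toCoordRing G p, fun g => by rw [coordAlg_ev, hp]; rfl⟩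
  · rintro ⟨a, ha⟩
    obtain ⟨p, rfl⟩ := toCoordRing_surjective G a
    exact ⟨p, fun g => by rw [← ha, coordAlg_ev]; rfl⟩

variable (G) in
/-- The standard representation. -/
noncomputable def stdRep : Representation k G (Fin n → k) :=
  (Matrix.toLinAlgEquiv' (R := k) (n := Fin n)).toAlgHom.toMonoidHom.comp
    ((Units.coeHom _).comp G.subtype)

lemma stdRep_apply (g : G) :
    stdRep G g = Matrix.toLin' ((g : GL (Fin n) k) : Matrix (Fin n) (Fin n) k) := rfl

/-- A matrix entry as a regular function. -/
noncomputable def entry (G : Subgroup (GL (Fin n) k)) (ij : Fin n × Fin n) : CoordRing G :=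
  toCoordRing G (MvPolynomial.X (Sum.inl ij))

lemma ev_entry (g : G) (ij : Fin n × Fin n) : (coordAlg G).ev g (entry G ij) =
    ((g : GL (Fin n) k) : Matrix (Fin n) (Fin n) k) ij.1 ij.2 := by
  rw [entry, coordAlg_ev, MvPolynomial.eval_X]; rfl

variable (G) in
lemma isRational_stdRep : (coordAlg G).IsRational (stdRep G) := by
  intro l x
  refine ⟨∑ i, ∑ j, (x j * l (Pi.single i 1)) • entry G (i, j), fun g => ?_⟩
  have : stdRep G g x = ∑ i, (∑ j, ((g : GL (Fin n) k) : Matrix (Fin n) (Fin n) k) i j * x j) •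
      (Pi.single i 1 : Fin n → k) := by
    ext i
    simp [stdRep_apply, Matrix.mulVec, dotProduct, Pi.single_apply, Finset.sum_apply]
  rw [this]
  simp only [map_sum, map_smul, ev_entry, smul_eq_mul, Finset.sum_mul]
  exact Finset.sum_congr rfl fun i _ => Finset.sum_congr rfl fun j _ => by ring

lemma entry_eq_coef (ij : Fin n × Fin n) : entry G ij =
    (isRational_stdRep G).coef (LinearMap.proj ij.1) (Pi.single ij.2 1) := by
  refine coordRing_ext fun g => ?_
  change (coordAlg G).ev g _ = (coordAlg G).ev g _
  rw [ev_entry, (isRational_stdRep G).ev_coef]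
  simp [stdRep_apply]

/-- The standard representation is infinitesimally faithful: `D` kills the entries of `g`, then
those of `g⁻¹` by differentiating `g * g⁻¹ = 1`, and these generate the ring. -/
lemma eq_zero_of_dAct_stdRep (D : (coordAlg G).lieAlg)
    (hD : (isRational_stdRep G).dAct D = 0) : D = 0 := by
  have hX : ∀ ij, D.1 (entry G ij) = 0 := fun ij => by
    rw [entry_eq_coef, (isRational_stdRep G).apply_coef, hD]; simp
  let y : Fin n × Fin n → CoordRing G := fun ij => toCoordRing G (MvPolynomial.X (Sum.inr ij))
  have hy : ∀ g ij, (coordAlg G).ev g (y ij) =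
      ((g⁻¹ : GL (Fin n) k) : Matrix (Fin n) (Fin n) k) ij.1 ij.2 := fun g ij => by
    rw [coordAlg_ev, MvPolynomial.eval_X]; rfl
  have h1 : ∀ i l, ∑ j, entry G (i, j) * y (j, l) = if i = l then 1 else 0 := by
    intro i l
    refine (coordAlg G).ext_ev fun g => ?_
    simp only [map_sum, map_mul, ev_entry, hy]
    rw [← Matrix.mul_apply, ← Units.val_mul, mul_inv_cancel, Units.val_one, Matrix.one_apply]
    split_ifs <;> simp
  have h2 : ∀ i l, ∑ j, y (i, j) * entry G (j, l) = if i = l then 1 else 0 := by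
    intro i l
    refine (coordAlg G).ext_ev fun g => ?_
    simp only [map_sum, map_mul, ev_entry, hy]
    rw [← Matrix.mul_apply, ← Units.val_mul, inv_mul_cancel, Units.val_one, Matrix.one_apply]
    split_ifs <;> simp
  have h3 : ∀ i l, ∑ j, entry G (i, j) * D.1 (y (j, l)) = 0 := by
    intro i l
    have h := congrArg D.1 (h1 i l)
    rw [map_sum] at h
    simp only [Derivation.leibniz, hX, smul_eq_mul, mul_zero, add_zero] at h
    rw [h]
    split_ifs
    · exact D.1.map_one_eq_zero
    · exact map_zero _
  have hY : ∀ ij, D.1 (y ij) = 0 := by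
    rintro ⟨m, l⟩
    have h : ∑ i, y (m, i) * ∑ j, entry G (i, j) * D.1 (y (j, l)) = 0 := by simp [h3]
    simp only [Finset.mul_sum] at h
    rw [Finset.sum_comm] at h
    simp only [← mul_assoc, ← Finset.sum_mul, h2] at h
    simpa using h
  refine Subtype.ext (Derivation.ext fun f => ?_)
  obtain ⟨p, rfl⟩ := toCoordRing_surjective G f
  change D.1 _ = 0
  induction p using MvPolynomial.induction_on with
  | C c =>
    have : toCoordRing G (MvPolynomial.C c) = algebraMap k _ c := (toCoordRing G).commutes c
    rw [this, Derivation.map_algebraMap]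
  | add p q hp hq => rw [map_add, map_add, hp, hq, add_zero]
  | mul_X p i hp =>
    have : D.1 (toCoordRing G (MvPolynomial.X i)) = 0 := by
      rcases i with ij | ij
      · exact hX ij
      · exact hY ij
    rw [map_mul, Derivation.leibniz, hp, this, smul_zero, smul_zero, add_zero]

/-- If a left invariant derivation acts nilpotently on the standard representation, then its
exponential satisfies all the equations of `G`. -/
lemma eval_exp_eq_zero [CharZero k] (D : (coordAlg G).lieAlg) (N : ℕ)
    (hN : (isRational_stdRep G).dAct D ^ N = 0) (p : MvPolynomial (Fin n × Fin n) k)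
    (hp : ∀ g ∈ G, MvPolynomial.eval
      (fun ij => (g : Matrix (Fin n) (Fin n) k) ij.1 ij.2) p = 0) :
    MvPolynomial.eval (fun ij => ∑ m ∈ Finset.range N, (m.factorial : k)⁻¹ *
      (((isRational_stdRep G).dAct D ^ m) (Pi.single ij.2 1) : Fin n → k) ij.1) p = 0 := by
  set x := (isRational_stdRep G).dAct D with hx
  -- The entries of `exp (t x)`, polynomial in `t` by nilpotency. They are the Taylor series at the
  -- identity of the entry functions, so the homomorphism `taylor` carries the equation `p = 0` on
  -- `G` to the whole curve; then `t = 1`.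
  let P : Fin n × Fin n → Polynomial k := fun ij => ∑ m ∈ Finset.range N,
    Polynomial.monomial m ((m.factorial : k)⁻¹ * ((x ^ m) (Pi.single ij.2 1) : Fin n → k) ij.1)
  have hpow : ∀ (m : ℕ) (l : Dual k (Fin n → k)) (v : Fin n → k),
      ((D.1 : CoordRing G →ₗ[k] CoordRing G) ^ m) ((isRational_stdRep G).coef l v) =
        (isRational_stdRep G).coef l ((x ^ m) v) := by
    intro m
    induction m with
    | zero => simp
    | succ m ih =>
      intro l v
      rw [pow_succ, pow_succ, End.mul_apply, End.mul_apply, Derivation.coeFn_coe,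
        (isRational_stdRep G).apply_coef, ih]
  have hP : ∀ ij, ((P ij : Polynomial k) : PowerSeries k) =
      taylor ((coordAlg G).ev 1) D.1 (entry G ij) := by
    intro ij
    ext m
    rw [coeff_taylor, entry_eq_coef, hpow, (isRational_stdRep G).ev_coef, Polynomial.coeff_coe,
      Polynomial.finsetSum_coeff]
    simp only [Polynomial.coeff_monomial, Finset.sum_ite_eq', Finset.mem_range, map_one]
    split_ifs with h
    · rfl
    · rw [not_lt] at h
      rw [pow_eq_zero_of_le h hN]
      simp
  have h1 : MvPolynomial.aeval (entry G) p = 0 := by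
    refine (coordAlg G).ext_ev fun g => ?_
    rw [map_zero, ← hp g g.2, ← MvPolynomial.aeval_eq_eval, ← AlgHom.comp_apply]
    congr 1
    ext ij
    simp [ev_entry]
  have h2 : MvPolynomial.aeval P p = 0 := by
    refine Polynomial.coe_injective k ?_
    have h := congrArg (taylor ((coordAlg G).ev 1) D.1) h1
    rw [map_zero, ← AlgHom.comp_apply] at h
    rw [Polynomial.coe_zero, ← h]
    change (Polynomial.coeToPowerSeries.algHom k).comp (MvPolynomial.aeval P) p = _
    congr 1
    ext1 ij
    simp [← hP]
  have h3 := congrArg (Polynomial.aeval (1 : k)) h2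
  rw [map_zero, ← AlgHom.comp_apply] at h3
  rw [← MvPolynomial.aeval_eq_eval, ← h3]
  congr 1
  ext ij
  simp [P, Polynomial.eval_finsetSum]

end CoordinateRing

/-! ### Reductivity excludes stable Lie algebras of nilpotent operators -/

section Key

variable {k : Type*} [Field k] {n : ℕ} {G : Subgroup (GL (Fin n) k)}

lemma isZariskiClosed_inter {S T : Set (GL (Fin n) k)} (hS : IsZariskiClosed S)
    (hT : IsZariskiClosed T) : IsZariskiClosed (S ∩ T) := by
  obtain ⟨I, hI⟩ := hS
  obtain ⟨J, hJ⟩ := hT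
  refine ⟨I ∪ J, fun g => ?_⟩
  rw [Set.mem_inter_iff, hI, hJ]
  exact ⟨fun h p hp => hp.elim (h.1 p) (h.2 p), fun h =>
    ⟨fun p hp => h p (Or.inl hp), fun p hp => h p (Or.inr hp)⟩⟩

/-- Conditions on `g - 1` given by a linear subspace of matrices are Zariski closed. -/
lemma isZariskiClosed_of_submodule (J : Submodule k (End k (Fin n → k))) :
    IsZariskiClosed {g : GL (Fin n) k |
      Matrix.toLin' (g : Matrix (Fin n) (Fin n) k) - 1 ∈ J} := by
  -- The polynomial `c l` computes `l (g - 1)`; the functionals vanishing on `J` cut out `J`.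
  let c : Dual k (End k (Fin n → k)) → MvPolynomial (Fin n × Fin n) k := fun l =>
    ∑ i, ∑ j, MvPolynomial.C (l (Matrix.toLin' (Matrix.single i j 1))) * MvPolynomial.X (i, j) -
      MvPolynomial.C (l 1)
  have hc : ∀ (l : Dual k (End k (Fin n → k))) (g : GL (Fin n) k),
      MvPolynomial.eval (fun ij => (g : Matrix (Fin n) (Fin n) k) ij.1 ij.2) (c l) =
        l (Matrix.toLin' (g : Matrix (Fin n) (Fin n) k) - 1) := by
    intro l g
    conv_rhs => rw [Matrix.matrix_eq_sum_single (g : Matrix (Fin n) (Fin n) k)]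
    have : ∀ i j, Matrix.single i j ((g : Matrix (Fin n) (Fin n) k) i j) =
        (g : Matrix (Fin n) (Fin n) k) i j • Matrix.single i j (1 : k) := fun i j => by
      rw [Matrix.smul_single, smul_eq_mul, mul_one]
    simp only [c, this, map_sub, map_sum, map_smul, map_mul, MvPolynomial.eval_C,
      MvPolynomial.eval_X, smul_eq_mul]
    congr 1
    exact Finset.sum_congr rfl fun i _ => Finset.sum_congr rfl fun j _ => mul_comm _ _
  refine ⟨c '' {l | J ≤ LinearMap.ker l}, fun g => ?_⟩
  rw [Set.forall_mem_image]
  simp only [hc]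
  constructor
  · exact fun h l hl => hl h
  · intro h
    by_contra hg
    obtain ⟨l, hl, hlJ⟩ := Submodule.exists_le_ker_of_notMem hg
    exact hl (h hlJ)

/-- A closed group of unipotent matrices in characteristic zero is connected. -/
lemma isZariskiConnected_of_unipotent [CharZero k] (H : Subgroup (GL (Fin n) k))
    (hH : IsZariskiClosed (H : Set (GL (Fin n) k))) (hu : IsUnipotentSubgroup H) :
    IsZariskiConnected (H : Set (GL (Fin n) k)) := by
  obtain ⟨I, hI⟩ := hH
  refine ⟨⟨1, H.one_mem⟩, fun Z₁ Z₂ hZ₁ hZ₂ hcov h₁ h₂ => ?_⟩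
  have main : ∀ Z₁ Z₂ : Set (GL (Fin n) k), IsZariskiClosed Z₁ → IsZariskiClosed Z₂ →
      (H : Set (GL (Fin n) k)) ⊆ Z₁ ∪ Z₂ → 1 ∈ Z₁ → ((H : Set (GL (Fin n) k)) ∩ Z₂).Nonempty →
      ((H : Set (GL (Fin n) k)) ∩ (Z₁ ∩ Z₂)).Nonempty := by
    rintro Z₁ Z₂ ⟨I₁, hI₁⟩ ⟨I₂, hI₂⟩ hcov h1 ⟨h, hh, hhZ⟩
    set N : Matrix (Fin n) (Fin n) k := (h : Matrix (Fin n) (Fin n) k) - 1 with hN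
    obtain ⟨K', hK'⟩ := hu h hh
    have hK : N ^ (K' + 1) = 0 := by rw [pow_succ, hK', zero_mul]
    have hnil : IsNilpotent N := ⟨_, hK⟩
    choose γ hγ using fun t : k => isUnit_powPath_succ N hnil K' t
    -- The entries of the polynomial path `h ^ t` from `1` to `h`. The path stays in `H`, since each
    -- equation of `H` vanishes at all natural `t` and hence identically.
    let Γ : Fin n × Fin n → Polynomial k := fun ij =>
      ∑ m ∈ Finset.range (K' + 1), Polynomial.C ((N ^ m) ij.1 ij.2) * binomPoly k m
    have hΓ : ∀ (p : MvPolynomial (Fin n × Fin n) k) (t : k),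
        (MvPolynomial.aeval Γ p).eval t = MvPolynomial.eval
          (fun ij => (γ t : Matrix (Fin n) (Fin n) k) ij.1 ij.2) p := by
      intro p t
      rw [← Polynomial.coe_aeval_eq_eval, ← MvPolynomial.aeval_eq_eval]
      change ((Polynomial.aeval t).comp (MvPolynomial.aeval Γ)) p = _
      congr 1
      ext ij
      simp [Γ, hγ, powPath, Polynomial.eval_finsetSum, Matrix.sum_apply, mul_comm]
    have hγnat : ∀ j : ℕ, γ (j : k) = h ^ j := by
      intro j
      ext1
      rw [hγ, powPath_natCast N _ hK, hN, add_sub_cancel, Units.val_pow_eq_pow_val]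
    have hγH : ∀ t, γ t ∈ H := by
      intro t
      refine (hI _).2 fun p hp => ?_
      rw [← hΓ, polynomial_eq_zero_of_natCast (MvPolynomial.aeval Γ p) fun j => ?_,
        Polynomial.eval_zero]
      rw [hΓ, hγnat]
      exact (hI _).1 (H.pow_mem hh j) p hp
    have hγ0 : γ 0 = 1 := by simpa using hγnat 0
    have hγ1 : γ 1 = h := by simpa using hγnat 1
    -- Irreducibility of the line: if the path leaves `Z₁`, some equation `p` of `Z₁` is nonzero
    -- along it. Its product with any equation `q` of `Z₂` vanishes at all natural `t`, so `q`
    -- vanishes along the path, and the point `1` lies in `Z₂`.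
    by_cases hall : ∀ t, γ t ∈ Z₁
    · exact ⟨h, hh, hγ1 ▸ hall 1, hhZ⟩
    · push Not at hall
      obtain ⟨t₀, ht₀⟩ := hall
      rw [hI₁] at ht₀
      push Not at ht₀
      obtain ⟨p, hp, hpt⟩ := ht₀
      refine ⟨1, H.one_mem, h1, (hI₂ _).2 fun q hq => ?_⟩
      have hpq : MvPolynomial.aeval Γ p * MvPolynomial.aeval Γ q = 0 := by
        refine polynomial_eq_zero_of_natCast _ fun j => ?_
        rw [Polynomial.eval_mul, hΓ, hΓ]
        rcases hcov (hγH j) with hj | hj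
        · rw [(hI₁ _).1 hj p hp, zero_mul]
        · rw [(hI₂ _).1 hj q hq, mul_zero]
      rcases mul_eq_zero.1 hpq with h0 | h0
      · rw [← hΓ, h0, Polynomial.eval_zero] at hpt
        exact absurd rfl hpt
      · rw [← hγ0, ← hΓ, h0, Polynomial.eval_zero]
  rcases hcov H.one_mem with h1 | h1
  · exact main Z₁ Z₂ hZ₁ hZ₂ hcov h1 h₂
  · rw [Set.inter_comm Z₁]
    exact main Z₂ Z₁ hZ₂ hZ₁ (by rwa [Set.union_comm]) h1 h₁

/-- The elements of `G` which act trivially on the graded pieces of a `G`-stable filtration. -/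
def shiftSubgroup (G : Subgroup (GL (Fin n) k)) (F : ℕ → Submodule k (Fin n → k))
    (hF : ∀ g : G, ∀ i, ∀ v ∈ F i, stdRep G g v ∈ F i) : Subgroup (GL (Fin n) k) where
  carrier := {g | g ∈ G ∧ Matrix.toLin' (g : Matrix (Fin n) (Fin n) k) - 1 ∈ shiftOps F}
  one_mem' := ⟨G.one_mem, by simp [← End.one_eq_id]⟩
  mul_mem' {g h} hg hh := ⟨G.mul_mem hg.1 hh.1, by
    have : Matrix.toLin' ((g * h : GL (Fin n) k) : Matrix (Fin n) (Fin n) k) - 1 =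
        Matrix.toLin' (g : Matrix (Fin n) (Fin n) k) *
          (Matrix.toLin' (h : Matrix (Fin n) (Fin n) k) - 1) +
        (Matrix.toLin' (g : Matrix (Fin n) (Fin n) k) - 1) := by
      rw [Units.val_mul, Matrix.toLin'_mul, ← End.mul_eq_comp, mul_sub, mul_one]; abel
    rw [this]
    exact add_mem (mul_mem_shiftOps (hF ⟨g, hg.1⟩) hh.2) hg.2⟩
  inv_mem' {g} hg := ⟨G.inv_mem hg.1, by
    have h1 : Matrix.toLin' ((g⁻¹ : GL (Fin n) k) : Matrix (Fin n) (Fin n) k) *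
        Matrix.toLin' (g : Matrix (Fin n) (Fin n) k) = 1 := by
      rw [End.mul_eq_comp, ← Matrix.toLin'_mul, ← Units.val_mul, inv_mul_cancel, Units.val_one,
        Matrix.toLin'_one]; rfl
    have : Matrix.toLin' ((g⁻¹ : GL (Fin n) k) : Matrix (Fin n) (Fin n) k) - 1 =
        -(Matrix.toLin' ((g⁻¹ : GL (Fin n) k) : Matrix (Fin n) (Fin n) k) *
          (Matrix.toLin' (g : Matrix (Fin n) (Fin n) k) - 1)) := by
      rw [mul_sub, h1, mul_one, neg_sub]
    rw [this]
    exact neg_mem (mul_mem_shiftOps (hF ⟨g⁻¹, G.inv_mem hg.1⟩) hg.2)⟩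

lemma shiftSubgroup_normal (F : ℕ → Submodule k (Fin n → k))
    (hF : ∀ g : G, ∀ i, ∀ v ∈ F i, stdRep G g v ∈ F i) :
    ((shiftSubgroup G F hF).subgroupOf G).Normal := by
  refine ⟨fun u hu g => ?_⟩
  rw [Subgroup.mem_subgroupOf] at *
  refine ⟨(g * u * g⁻¹).2, fun i v hv => ?_⟩
  have h1 : stdRep G g (stdRep G g⁻¹ v) = v := by
    rw [← End.mul_apply, ← map_mul, mul_inv_cancel, map_one, End.one_apply]
  have h2 : (Matrix.toLin' (((g * u * g⁻¹ : G) : GL (Fin n) k) : Matrix (Fin n) (Fin n) k) - 1) v =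
      stdRep G g ((Matrix.toLin' ((u : GL (Fin n) k) : Matrix (Fin n) (Fin n) k) - 1)
        (stdRep G g⁻¹ v)) := by
    change (stdRep G (g * u * g⁻¹) - 1) v = stdRep G g ((stdRep G u - 1) (stdRep G g⁻¹ v))
    simp only [LinearMap.sub_apply, map_sub, End.one_apply, h1, map_mul, End.mul_apply]
  rw [h2]
  exact hF _ _ _ (hu.2 i _ (hF _ _ _ hv))

/-- In a reductive group, a stable Lie algebra of nilpotent elements is trivial. -/
theorem IsReductive.eq_bot_of_isNilpotent [CharZero k] (hG : IsReductive G)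
    (r : Submodule k (coordAlg G).lieAlg) (hlie : ∀ x ∈ r, ∀ y ∈ r, ⁅x, y⁆ ∈ r)
    (hAd : ∀ g, ∀ x ∈ r, (coordAlg G).Ad g x ∈ r)
    (hnil : ∀ x ∈ r, IsNilpotent ((isRational_stdRep G).dAct x)) : r = ⊥ := by
  let L : LieSubalgebra k (coordAlg G).lieAlg := { r with lie_mem' := fun hx hy => hlie _ hx _ hy }
  let f : L →ₗ[k] End k (Fin n → k) := (isRational_stdRep G).dAct ∘ₗ r.subtype
  obtain ⟨N, hN⟩ := exists_flag_eq_bot f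
    (fun x y => (isRational_stdRep G).dAct_lie x.1 y.1) (fun x => hnil x.1 x.2)
  set F := flag f with hFdef
  have hF : ∀ g : G, ∀ i, ∀ v ∈ F i, stdRep G g v ∈ F i := by
    intro g i
    refine map_flag_le f (stdRep G g) (fun x => ⟨(coordAlg G).Ad g x.1, hAd g x.1 x.2⟩) ?_ i
    intro x v
    change _ = (isRational_stdRep G).dAct ((coordAlg G).Ad g x.1) (stdRep G g v)
    have hv : stdRep G g⁻¹ (stdRep G g v) = v := by
      rw [← End.mul_apply, ← map_mul, inv_mul_cancel, map_one, End.one_apply]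
    rw [(isRational_stdRep G).dAct_Ad, End.mul_apply, End.mul_apply, hv]
    rfl
  set H := shiftSubgroup G F hF with hH
  have hHc : IsZariskiClosed (H : Set (GL (Fin n) k)) :=
    isZariskiClosed_inter hG.1 (isZariskiClosed_of_submodule (shiftOps F))
  have hHu : IsUnipotentSubgroup H := by
    intro g hg
    refine ⟨N, ?_⟩
    have h1 := pow_eq_zero_of_mem_shiftOps rfl hN hg.2
    have h2 : Matrix.toLinAlgEquiv' ((g : Matrix (Fin n) (Fin n) k) - 1) =
        Matrix.toLin' (g : Matrix (Fin n) (Fin n) k) - 1 := by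
      rw [map_sub, map_one]; rfl
    rw [← h2, ← map_pow] at h1
    exact (map_eq_zero_iff _ (AlgEquiv.injective _)).1 h1
  -- The subgroup respecting the flag is closed, normal and unipotent, and connected by
  -- characteristic zero, so reductivity applies.
  have hbot : H = ⊥ := hG.2 H (fun g hg => hg.1) (shiftSubgroup_normal F hF) hHc
    (isZariskiConnected_of_unipotent H hHc hHu) hHu
  rw [eq_bot_iff]
  intro x hx
  rw [Submodule.mem_bot]
  refine eq_zero_of_dAct_stdRep x ?_
  set X := (isRational_stdRep G).dAct x with hX
  have hXF : X ∈ shiftOps F := fun i v hv => apply_mem_flag f ⟨x, hx⟩ hv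
  have hXN : X ^ N = 0 := pow_eq_zero_of_mem_shiftOps rfl hN hXF
  have hXnil : IsNilpotent X := ⟨N, hXN⟩
  have hXpow : ∀ m, ∀ i, ∀ v ∈ F i, (X ^ m) v ∈ F i := by
    intro m
    induction m with
    | zero => intro i v hv; simpa using hv
    | succ m ih =>
      intro i v hv
      rw [pow_succ', End.mul_apply]
      have hanti : F (i + 1) ≤ F i := by
        clear * -
        induction i with
        | zero => exact le_top
        | succ i ih =>
          refine Submodule.span_le.2 ?_
          rintro _ ⟨x, v, hv, rfl⟩
          exact apply_mem_flag f x (ih hv)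
      exact hanti (hXF i _ (ih i v hv))
  -- The matrix of `exp X` satisfies the equations of `G`, and `exp X - 1` shifts the flag. So `exp
  -- X` lies in the trivial group `H`.
  let M : Matrix (Fin n) (Fin n) k := LinearMap.toMatrix' (IsNilpotent.exp X)
  have hexp : IsNilpotent.exp X = ∑ m ∈ Finset.range N, (m.factorial : k)⁻¹ • X ^ m := by
    rw [IsNilpotent.exp_eq_sum hXN]
    refine Finset.sum_congr rfl fun m _ => ?_
    rw [← Rat.cast_smul_eq_qsmul k, Rat.cast_inv, Rat.cast_natCast]
  have hMu : IsUnit M := by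
    have := (IsNilpotent.isUnit_exp hXnil).map (LinearMap.toMatrixAlgEquiv' (R := k) (n := Fin n))
    exact this
  obtain ⟨g, hg⟩ := hMu
  have hlin : Matrix.toLin' (g : Matrix (Fin n) (Fin n) k) = IsNilpotent.exp X := by
    rw [hg, Matrix.toLin'_toMatrix']
  have hgG : g ∈ G := by
    obtain ⟨I, hI⟩ := hG.1
    refine (hI g).2 fun p hp => ?_
    rw [← eval_exp_eq_zero x N hXN p fun h hh => (hI h).1 hh p hp]
    congr 2
    ext ij
    rw [hg]
    change LinearMap.toMatrix' (IsNilpotent.exp X) ij.1 ij.2 = _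
    rw [LinearMap.toMatrix'_apply, hexp]
    simp only [LinearMap.sum_apply, LinearMap.smul_apply, Finset.sum_apply, Pi.smul_apply,
      smul_eq_mul]
    rfl
  have hN0 : N = 0 ∨ ∃ N', N = N' + 1 := by cases N <;> simp
  have hgH : g ∈ H := by
    refine ⟨hgG, ?_⟩
    rw [hlin, hexp]
    rcases hN0 with rfl | ⟨N', rfl⟩
    · intro i v hv
      have : F 0 = ⊤ := rfl
      rw [hN] at this
      have hv0 : v = 0 := by
        have : v ∈ (⊥ : Submodule k (Fin n → k)) := this.ge Submodule.mem_top
        simpa using this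
      rw [hv0, map_zero]; exact zero_mem _
    · rw [Finset.sum_range_succ']
      simp only [Nat.factorial_zero, Nat.cast_one, inv_one, pow_zero, one_smul, add_sub_cancel_right]
      refine sum_mem fun m _ => Submodule.smul_mem _ _ ?_
      rw [pow_succ]
      exact mul_mem_shiftOps (hXpow m) hXF
  rw [hbot, Subgroup.mem_bot] at hgH
  have hexp1 : IsNilpotent.exp X = 1 := by
    rw [← hlin, hgH, Units.val_one, Matrix.toLin'_one]; rfl
  by_contra hX0
  -- With `X ^ (m + 1)` the last nonzero power, `exp X * X ^ m = X ^ m + X ^ (m + 1)`, which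
  -- contradicts `exp X = 1`.
  obtain ⟨m, hm, hm'⟩ : ∃ m, X ^ (m + 1) ≠ 0 ∧ X ^ (m + 2) = 0 := by
    have hex : ∃ m, X ^ (m + 2) = 0 := ⟨N, pow_eq_zero_of_le (by omega) hXN⟩
    classical
    refine ⟨Nat.find hex, fun h0 => ?_, Nat.find_spec hex⟩
    rcases hc : Nat.find hex with _ | m
    · rw [hc] at h0; simp at h0; exact hX0 h0
    · rw [hc] at h0
      exact Nat.find_min hex (m := m) (by omega) h0
  have h3 : IsNilpotent.exp X * X ^ m = X ^ m + X ^ (m + 1) := by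
    rw [IsNilpotent.exp_eq_sum hm', Finset.sum_range_succ', Finset.sum_range_succ', add_mul,
      add_mul, Finset.sum_mul, Finset.sum_eq_zero fun i _ => ?_]
    · simp [pow_succ', add_comm]
    · rw [smul_mul_assoc, ← pow_add, pow_eq_zero_of_le (by omega) hm', smul_zero]
  rw [hexp1, one_mul, left_eq_add] at h3
  exact hm h3

/-- Reductive groups in characteristic zero are linearly reductive. -/
theorem IsReductive.linearlyReductive [IsAlgClosed k] [CharZero k] (hG : IsReductive G) :
    (coordAlg G).LinearlyReductive := fun hρ ε hε hε0 =>
  FunctionAlgebra.exists_invariant (isRational_stdRep G)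
    (fun r h1 h2 h3 => hG.eq_bot_of_isNilpotent r h1 h2 h3) _ hρ rfl ε hε hε0

end Key

/-! ### Powers of unipotent algebra automorphisms with exponent in `k` -/

section PowersOfAutomorphisms

variable {k R : Type*} [Field k] [CommRing R] [Algebra k R]

/-- The operator `σ - 1`. -/
def subOne (σ : R ≃ₐ[k] R) : End k R := σ.toLinearMap - 1

lemma subOne_apply (σ : R ≃ₐ[k] R) (x : R) : subOne σ x = σ x - x := rfl

lemma one_add_subOne_pow_apply (σ : R ≃ₐ[k] R) (j : ℕ) (x : R) :
    ((1 + subOne σ) ^ j) x = (σ ^ j) x := by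
  induction j generalizing x with
  | zero => simp
  | succ j ih => rw [pow_succ, pow_succ, End.mul_apply, ih]; simp [subOne_apply]

variable [CharZero k]

/-- Binomial powers of a unipotent automorphism are multiplicative. -/
lemma powPath_subOne_mul (σ : R ≃ₐ[k] R) (K : ℕ) (hK : subOne σ ^ K = 0) (t : k) (x y : R) :
    powPath (subOne σ) K t (x * y) = powPath (subOne σ) K t x * powPath (subOne σ) K t y := by
  refine eq_of_forall_dual (k := k) fun l => ?_
  -- After pairing with `l`, the failure of multiplicativity is polynomial in `t`; it vanishes at
  -- natural `t`, where the path is an actual power of `σ`.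
  let P : Polynomial k := ∑ m ∈ Finset.range K, Polynomial.C (l ((subOne σ ^ m) (x * y))) *
      binomPoly k m -
    ∑ i ∈ Finset.range K, ∑ j ∈ Finset.range K,
      Polynomial.C (l ((subOne σ ^ i) x * (subOne σ ^ j) y)) * (binomPoly k i * binomPoly k j)
  have hP : ∀ t, P.eval t = l (powPath (subOne σ) K t (x * y)) -
      l (powPath (subOne σ) K t x * powPath (subOne σ) K t y) := by
    intro t
    simp only [P, powPath, Polynomial.eval_sub, Polynomial.eval_finsetSum, Polynomial.eval_mul,
      Polynomial.eval_C, LinearMap.sum_apply, LinearMap.smul_apply, map_sum, map_smul,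
      smul_eq_mul, Finset.sum_mul_sum, smul_mul_assoc, mul_smul_comm]
    congr 1
    · exact Finset.sum_congr rfl fun m _ => mul_comm _ _
    · exact Finset.sum_congr rfl fun i _ => Finset.sum_congr rfl fun j _ => by ring
  have h0 : P = 0 := polynomial_eq_zero_of_natCast P fun j => by
    rw [hP, powPath_natCast _ _ hK, one_add_subOne_pow_apply, one_add_subOne_pow_apply,
      one_add_subOne_pow_apply, map_mul, sub_self]
  have := hP t
  rwa [h0, Polynomial.eval_zero, eq_comm, sub_eq_zero] at this

lemma powPath_succ_subOne_algebraMap (σ : R ≃ₐ[k] R) (K : ℕ) (t c : k) :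
    powPath (subOne σ) (K + 1) t (algebraMap k R c) = algebraMap k R c := by
  rw [powPath, Finset.sum_range_succ', LinearMap.add_apply, LinearMap.sum_apply,
    Finset.sum_eq_zero fun m _ => ?_]
  · simp [binomPoly]
  · rw [pow_succ, LinearMap.smul_apply, End.mul_apply, subOne_apply, AlgEquiv.commutes, sub_self,
      map_zero, smul_zero]

/-- The binomial power `σ ^ t` of a unipotent automorphism. -/
noncomputable def unipotentPow (σ : R ≃ₐ[k] R) (K : ℕ) (hK : subOne σ ^ (K + 1) = 0) (t : k) :
    R ≃ₐ[k] R :=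
  AlgEquiv.ofBijective
    (AlgHom.ofLinearMap (powPath (subOne σ) (K + 1) t)
      (by simpa using powPath_succ_subOne_algebraMap σ K t 1)
      (powPath_subOne_mul σ (K + 1) hK t))
    ((End.isUnit_iff _).1 (isUnit_powPath_succ (subOne σ) ⟨_, hK⟩ K t))

lemma unipotentPow_apply (σ : R ≃ₐ[k] R) (K : ℕ) (hK : subOne σ ^ (K + 1) = 0) (t : k) (x : R) :
    unipotentPow σ K hK t x = powPath (subOne σ) (K + 1) t x := rfl

lemma unipotentPow_apply_of_eq_zero (σ : R ≃ₐ[k] R) (K : ℕ) (hK : subOne σ ^ (K + 1) = 0)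
    (h : subOne σ = 0) (t : k) (x : R) : unipotentPow σ K hK t x = x := by
  rw [unipotentPow_apply, h, powPath, Finset.sum_range_succ']
  simp [binomPoly]

/-- The binomial series stops after its linear term, so `σ ^ t = 1 + t (σ - 1)`. The truncation
index `K + 1 + 1` ensures that this linear term is present. -/
lemma subOne_unipotentPow_of_sq (σ : R ≃ₐ[k] R) (K : ℕ) (hK : subOne σ ^ (K + 1 + 1) = 0)
    (h : subOne σ ^ 2 = 0) (t : k) : subOne (unipotentPow σ (K + 1) hK t) = t • subOne σ := by
  change powPath (subOne σ) (K + 1 + 1) t - 1 = _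
  rw [powPath, Finset.sum_range_succ', Finset.sum_range_succ', Finset.sum_eq_zero fun m _ => ?_]
  · simp [binomPoly]
  · rw [pow_eq_zero_of_le (by omega) h, smul_zero]

end PowersOfAutomorphisms

/-! ### Formal automorphisms trivial to first order -/

section Formal

variable {k : Type*} [Field k]
variable {A B C : Type*} [CommRing A] [IsLocalRing A] [Algebra k A]
    [CommRing B] [IsLocalRing B] [Algebra k B] [CommRing C] [IsLocalRing C] [Algebra k C]

lemma Trunc.proj_surjective {r s : ℕ} (h : r ≤ s) : Function.Surjective (Trunc.proj k A h) :=
  Ideal.Quotient.factor_surjective (Ideal.pow_le_pow_right (Nat.succ_le_succ h))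

/-- The ideal of `A / 𝔪 ^ (r + 1)` generated by `𝔪`. -/
def Trunc.maxIdeal (A : Type*) [CommRing A] [IsLocalRing A] (r : ℕ) : Ideal (Trunc A r) :=
  (IsLocalRing.maximalIdeal A).map (Ideal.Quotient.mk _)

lemma Trunc.maxIdeal_pow_eq_bot (r : ℕ) : Trunc.maxIdeal A r ^ (r + 1) = ⊥ := by
  rw [Trunc.maxIdeal, ← Ideal.map_pow, Ideal.map_quotient_self]

lemma Trunc.mem_maxIdeal_pow {r s : ℕ} (h : r ≤ s) {x : Trunc A s}
    (hx : Trunc.proj k A h x = 0) : x ∈ Trunc.maxIdeal A s ^ (r + 1) := by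
  obtain ⟨y, rfl⟩ := Ideal.Quotient.mk_surjective x
  have hy : y ∈ IsLocalRing.maximalIdeal A ^ (r + 1) := Ideal.Quotient.eq_zero_iff_mem.1 hx
  rw [Trunc.maxIdeal, ← Ideal.map_pow]
  exact Ideal.mem_map_of_mem _ hy

namespace FormalIso

variable (k B) in
/-- The identity. -/
def refl : FormalIso k B B where
  iso _ := AlgEquiv.refl
  compat _ _ := rfl

/-- Composition of formal isomorphisms. -/
def trans (u : FormalIso k A B) (v : FormalIso k B C) : FormalIso k A C where
  iso r := (u.iso r).trans (v.iso r)
  compat h x := by simp [v.compat h, u.compat h]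

/-- The inverse of a formal isomorphism. -/
def symm (u : FormalIso k A B) : FormalIso k B A where
  iso r := (u.iso r).symm
  compat {r s} h x := by
    apply (u.iso r).injective
    rw [← u.compat h]
    simp

@[simp] lemma trans_iso (u : FormalIso k A B) (v : FormalIso k B C) (r : ℕ) (x : Trunc A r) :
    (u.trans v).iso r x = v.iso r (u.iso r x) := rfl

@[simp] lemma iso_symm_iso (u : FormalIso k A B) (r : ℕ) (x : Trunc B r) :
    u.iso r (u.symm.iso r x) = x := (u.iso r).apply_symm_apply x

@[simp] lemma symm_iso_iso (u : FormalIso k A B) (r : ℕ) (x : Trunc A r) :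
    u.symm.iso r (u.iso r x) = x := (u.iso r).symm_apply_apply x

/-- Formal isomorphisms which agree at some level agree at all lower levels. -/
lemma eq_of_le {u v : FormalIso k A B} {r s : ℕ} (h : r ≤ s)
    (H : ∀ x, u.iso s x = v.iso s x) (x : Trunc A r) : u.iso r x = v.iso r x := by
  obtain ⟨y, rfl⟩ := Trunc.proj_surjective (k := k) h x
  rw [← u.compat, ← v.compat, H]

lemma IsEquivariantAt.of_le {n : ℕ} {G : Subgroup (GL (Fin n) k)} {u : FormalIso k A B}
    {a : FormalAction G A} {b : FormalAction G B} {r s : ℕ} (h : r ≤ s)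
    (H : u.IsEquivariantAt a b s) : u.IsEquivariantAt a b r := by
  intro g x
  obtain ⟨y, rfl⟩ := Trunc.proj_surjective (k := k) h x
  rw [← a.compat, ← u.compat, H, b.compat, u.compat]

lemma sub_mem_of_eq {θ : FormalIso k B B} {r s : ℕ} (h : r ≤ s) (hθ : ∀ x, θ.iso r x = x)
    (x : Trunc B s) : θ.iso s x - x ∈ Trunc.maxIdeal B s ^ (r + 1) := by
  refine Trunc.mem_maxIdeal_pow (k := k) h ?_
  rw [map_sub, θ.compat h, hθ, sub_self]

lemma sub_mem_sq {θ : FormalIso k B B} (hθ : ∀ x, θ.iso 1 x = x) (s : ℕ) (x : Trunc B s) :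
    θ.iso s x - x ∈ Trunc.maxIdeal B s ^ 2 := by
  rcases Nat.eq_zero_or_pos s with rfl | hs
  · have : θ.iso 0 x = x := by
      obtain ⟨y, rfl⟩ := Trunc.proj_surjective (k := k) zero_le_one x
      rw [← θ.compat, hθ]
    rw [this, sub_self]
    exact zero_mem _
  · exact sub_mem_of_eq hs hθ x

/-- A formal automorphism which is trivial to first order shifts the adic filtration. -/
lemma subOne_mem_shiftOps {θ : FormalIso k B B} (hθ : ∀ x, θ.iso 1 x = x) (s : ℕ) :
    subOne (θ.iso s) ∈ shiftOps fun i => (Trunc.maxIdeal B s ^ i).restrictScalars k := by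
  intro i
  induction i with
  | zero =>
    intro x _
    rw [subOne_apply]
    exact Ideal.pow_le_pow_right one_le_two (sub_mem_sq hθ s x)
  | succ i ih =>
    intro x hx
    simp only [Submodule.restrictScalars_mem] at *
    rw [pow_succ (Trunc.maxIdeal B s) i] at hx
    induction hx using Submodule.mul_induction_on' with
    | mem_mul_mem a ha b hb =>
      -- Twisted Leibniz rule `(θ - 1)(a b) = (θ - 1) a * b + θ a * (θ - 1) b`. The first term gains
      -- a degree by induction, the second because `θ - 1` maps everything into the square of the
      -- maximal ideal.
      have h1 : subOne (θ.iso s) (a * b) =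
          subOne (θ.iso s) a * b + (a + subOne (θ.iso s) a) * (θ.iso s b - b) := by
        simp only [subOne_apply, map_mul]; ring
      rw [h1]
      have h2 := ih a ha
      refine add_mem (by rw [pow_succ (Trunc.maxIdeal B s) (i + 1)]; exact Ideal.mul_mem_mul h2 hb) ?_
      rw [show i + 1 + 1 = i + 2 by ring, pow_add (Trunc.maxIdeal B s)]
      exact Ideal.mul_mem_mul (add_mem ha (Ideal.pow_le_pow_right (Nat.le_succ i) h2))
        (sub_mem_sq hθ s b)
    | add a _ b _ ha hb => rw [map_add]; exact add_mem ha hb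

lemma subOne_pow_eq_zero {θ : FormalIso k B B} (hθ : ∀ x, θ.iso 1 x = x) (s : ℕ) :
    subOne (θ.iso s) ^ (s + 1) = 0 := by
  refine pow_eq_zero_of_mem_shiftOps (by simp) ?_ (subOne_mem_shiftOps hθ s)
  simp [Trunc.maxIdeal_pow_eq_bot]

/-- The image of `θ - 1` lies in the `(r + 1)`-st power of the maximal ideal, and `θ' - 1` raises it
to the `(r + 2)`-nd, which is zero at level `r + 1`. Composition therefore becomes additive there.
-/
lemma subOne_subOne_eq_zero {θ θ' : FormalIso k B B} {r : ℕ} (hr : 1 ≤ r)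
    (hθ' : ∀ x, θ'.iso r x = x) (hθ : ∀ x, θ.iso r x = x) (x : Trunc B (r + 1)) :
    subOne (θ'.iso (r + 1)) (subOne (θ.iso (r + 1)) x) = 0 := by
  have h1 := subOne_mem_shiftOps (fun x => θ'.eq_of_le (v := refl k B) hr hθ' x)
    (r + 1) (r + 1) _ (sub_mem_of_eq (Nat.le_succ r) hθ x)
  rw [Submodule.restrictScalars_mem, Trunc.maxIdeal_pow_eq_bot, Ideal.mem_bot] at h1
  exact h1

variable [CharZero k]

/-- The binomial power of a formal automorphism which is trivial to first order. -/
noncomputable def pow (θ : FormalIso k B B) (hθ : ∀ x, θ.iso 1 x = x) (t : k) :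
    FormalIso k B B where
  iso s := unipotentPow (θ.iso s) s (subOne_pow_eq_zero hθ s) t
  compat {r s} h x := by
    have hpow : ∀ (m : ℕ) (x : Trunc B s), Trunc.proj k B h ((subOne (θ.iso s) ^ m) x) =
        (subOne (θ.iso r) ^ m) (Trunc.proj k B h x) := by
      intro m
      induction m with
      | zero => intro x; simp
      | succ m ih =>
        intro x
        rw [pow_succ (subOne (θ.iso s)), pow_succ (subOne (θ.iso r)), End.mul_apply,
          End.mul_apply, ih, subOne_apply, subOne_apply, map_sub, θ.compat h]
    rw [unipotentPow_apply, unipotentPow_apply, powPath, powPath, LinearMap.sum_apply,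
      LinearMap.sum_apply, map_sum]
    simp only [LinearMap.smul_apply, map_smul, hpow]
    -- The two levels truncate the series differently, but the extra terms vanish at level `r`.
    symm
    refine Finset.sum_subset (Finset.range_mono (Nat.succ_le_succ h)) fun m _ hm => ?_
    rw [Finset.mem_range, not_lt] at hm
    rw [pow_eq_zero_of_le hm (subOne_pow_eq_zero hθ r)]
    simp

lemma pow_iso (θ : FormalIso k B B) (hθ : ∀ x, θ.iso 1 x = x) (t : k) (s : ℕ) :
    (θ.pow hθ t).iso s = unipotentPow (θ.iso s) s (subOne_pow_eq_zero hθ s) t := rfl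

lemma subOne_eq_zero {θ : FormalIso k B B} {r : ℕ} (hθ : ∀ x, θ.iso r x = x) :
    subOne (θ.iso r) = 0 :=
  LinearMap.ext fun x => by rw [subOne_apply, hθ, sub_self, LinearMap.zero_apply]

lemma subOne_sq_eq_zero {θ : FormalIso k B B} {r : ℕ} (hr : 1 ≤ r) (hθ : ∀ x, θ.iso r x = x) :
    subOne (θ.iso (r + 1)) ^ 2 = 0 :=
  LinearMap.ext fun x => by
    rw [pow_two, End.mul_apply, subOne_subOne_eq_zero hr hθ hθ, LinearMap.zero_apply]

lemma subOne_trans {θ θ' : FormalIso k B B} {r : ℕ} (hr : 1 ≤ r) (hθ : ∀ x, θ.iso r x = x)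
    (hθ' : ∀ x, θ'.iso r x = x) : subOne ((θ.trans θ').iso (r + 1)) =
      subOne (θ.iso (r + 1)) + subOne (θ'.iso (r + 1)) := by
  refine LinearMap.ext fun x => ?_
  have h2 := subOne_subOne_eq_zero hr hθ' hθ x
  rw [subOne_apply, subOne_apply, map_sub, sub_eq_zero, sub_eq_iff_eq_add] at h2
  rw [LinearMap.add_apply, subOne_apply, subOne_apply, subOne_apply, trans_iso, h2]
  abel

variable (k B) in
/-- The formal automorphisms which are trivial at level `r`, through their effect at level
`r + 1`. -/
noncomputable def deformations (r : ℕ) (hr : 1 ≤ r) : Submodule k (End k (Trunc B (r + 1))) where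
  carrier := {q | ∃ θ : FormalIso k B B, (∀ x, θ.iso r x = x) ∧ subOne (θ.iso (r + 1)) = q}
  zero_mem' := ⟨refl k B, fun _ => rfl, LinearMap.ext fun x => sub_self x⟩
  add_mem' := by
    rintro _ _ ⟨θ, hθ, rfl⟩ ⟨θ', hθ', rfl⟩
    refine ⟨θ.trans θ', fun x => by rw [trans_iso, hθ, hθ'], subOne_trans hr hθ hθ'⟩
  -- Scaling must be realised by a formal automorphism on all levels; the binomial power `θ ^ t`
  -- provides one, and at level `r + 1` it multiplies `θ - 1` by `t`.
  smul_mem' := by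
    rintro t _ ⟨θ, hθ, rfl⟩
    have hθ1 : ∀ x, θ.iso 1 x = x := fun x => θ.eq_of_le (v := refl k B) hr hθ x
    refine ⟨θ.pow hθ1 t, fun x => ?_, ?_⟩
    · rw [pow_iso, unipotentPow_apply_of_eq_zero _ _ _ (subOne_eq_zero hθ)]
    · rw [pow_iso, subOne_unipotentPow_of_sq _ _ _ (subOne_sq_eq_zero hr hθ)]

end FormalIso

end Formal

/-! ### Correcting a formal isomorphism one level at a time -/

section Equivariance

variable {k : Type*} [Field k] {n : ℕ} {G : Subgroup (GL (Fin n) k)}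

lemma exists_ev_inv (f : CoordRing G) :
    ∃ f' : CoordRing G, ∀ g, (coordAlg G).ev g f' = (coordAlg G).ev g⁻¹ f := by
  obtain ⟨p, rfl⟩ := toCoordRing_surjective G f
  refine ⟨toCoordRing G (MvPolynomial.rename Sum.swap p), fun g => ?_⟩
  rw [coordAlg_ev, coordAlg_ev, MvPolynomial.eval_rename]
  congr 2
  ext ij
  rcases ij with ij | ij <;> simp [entries]

lemma isRational_linHom {V W : Type*} [AddCommGroup V] [Module k V] [FiniteDimensional k V]
    [AddCommGroup W] [Module k W] {ρ : Representation k G V} {τ : Representation k G W}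
    (hρ : (coordAlg G).IsRational ρ) (hτ : (coordAlg G).IsRational τ) :
    (coordAlg G).IsRational (ρ.linHom τ) := by
  intro l f
  let e := Module.finBasis k V
  choose y hy using fun i j => exists_ev_inv (hρ.coef (e.coord j) (e i))
  -- `L i` is `l` evaluated on rank one maps supported on `e i`. It reduces a coefficient of the
  -- conjugation action to coefficients of `τ` at `g` and of `ρ` at `g⁻¹`.
  let L : Fin (finrank k V) → Dual k W := fun i => l ∘ₗ LinearMap.smulRightₗ (e.coord i)
  have hL : ∀ h : V →ₗ[k] W, l h = ∑ i, L i (h (e i)) := by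
    intro h
    have : h = ∑ i, LinearMap.smulRightₗ (e.coord i) (h (e i)) := by
      refine e.ext fun j => ?_
      simp [LinearMap.sum_apply, Finsupp.single_apply, Basis.coord_apply]
    conv_lhs => rw [this]
    simp [L]
  refine ⟨∑ i, ∑ j, y i j * hτ.coef (L i) (f (e j)), fun g => ?_⟩
  rw [hL]
  simp only [map_sum, map_mul, hy, FunctionAlgebra.IsRational.ev_coef]
  refine Finset.sum_congr rfl fun i _ => ?_
  have h1 : ρ g⁻¹ (e i) = ∑ j, e.coord j (ρ g⁻¹ (e i)) • e j := (e.sum_repr _).symm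
  have h2 : (ρ.linHom τ g f) (e i) = τ g (f (ρ g⁻¹ (e i))) := rfl
  rw [h2]
  conv_rhs => rw [h1]
  simp only [map_sum, map_smul, smul_eq_mul]

variable {A B : Type*} [CommRing A] [IsLocalRing A] [Algebra k A]
    [CommRing B] [IsLocalRing B] [Algebra k B]

namespace FormalAction

/-- The formal automorphism given by an element of the group. -/
def formalIso (a : FormalAction G A) (g : G) : FormalIso k A A where
  iso r := a.act r g
  compat h x := a.compat h g x

/-- The representation on `A / 𝔪 ^ (r + 1)` underlying an action. -/
def rep (a : FormalAction G A) (r : ℕ) : Representation k G (Trunc A r) where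
  toFun g := (a.act r g).toLinearMap
  map_one' := by rw [map_one]; rfl
  map_mul' g h := by rw [map_mul]; rfl

lemma isRational_rep (a : FormalAction G A) (r : ℕ) : (coordAlg G).IsRational (a.rep r) :=
  fun l x => (isRegularFun_iff _).1 (a.regular r x l)

lemma act_act_inv (a : FormalAction G A) (r : ℕ) (g : G) (x : Trunc A r) :
    a.act r g (a.act r g⁻¹ x) = x := by
  rw [← AlgEquiv.mul_apply, ← map_mul, mul_inv_cancel, map_one, AlgEquiv.one_apply]

lemma act_inv_act (a : FormalAction G A) (r : ℕ) (g : G) (x : Trunc A r) :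
    a.act r g⁻¹ (a.act r g x) = x := by
  rw [← AlgEquiv.mul_apply, ← map_mul, inv_mul_cancel, map_one, AlgEquiv.one_apply]

end FormalAction

/-- Two formal isomorphisms which agree at level `r` differ by a deformation. -/
lemma FormalIso.exists_deformation [CharZero k] (w w' : FormalIso k A B) (r : ℕ) (hr : 1 ≤ r)
    (h : ∀ x, w'.iso r x = w.iso r x) : ∃ q ∈ FormalIso.deformations k B r hr,
      ∀ x, w'.iso (r + 1) x = w.iso (r + 1) x + q (w.iso (r + 1) x) := by
  refine ⟨_, ⟨w.symm.trans w', fun x => ?_, rfl⟩, fun x => ?_⟩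
  · rw [FormalIso.trans_iso, h, FormalIso.iso_symm_iso]
  · rw [subOne_apply, FormalIso.trans_iso, FormalIso.symm_iso_iso, add_sub_cancel]

/-- An equivariant formal isomorphism of level `r` can be modified to be equivariant at level
`r + 1`. -/
lemma FormalIso.exists_isEquivariantAt_succ [IsAlgClosed k] [CharZero k] (hG : IsReductive G)
    (a : FormalAction G A) (b : FormalAction G B) (r : ℕ) (hr : 1 ≤ r)
    [FiniteDimensional k (Trunc A (r + 1))] [FiniteDimensional k (Trunc B (r + 1))]
    (w : FormalIso k A B) (hw : w.IsEquivariantAt a b r) :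
    ∃ w' : FormalIso k A B, (∀ x, w'.iso r x = w.iso r x) ∧ w'.IsEquivariantAt a b (r + 1) := by
  let ρ := (a.rep (r + 1)).linHom (b.rep (r + 1))
  have hρ : (coordAlg G).IsRational ρ :=
    isRational_linHom (a.isRational_rep (r + 1)) (b.isRational_rep (r + 1))
  let w₁ : Trunc A (r + 1) →ₗ[k] Trunc B (r + 1) := (w.iso (r + 1)).toLinearMap
  -- By `hQ_of` and `hQ_to`, `w₁ + Q` is exactly the set of level `r + 1` components of formal
  -- isomorphisms agreeing with `w` at level `r`.
  let Q : Submodule k (Trunc A (r + 1) →ₗ[k] Trunc B (r + 1)) :=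
    (FormalIso.deformations k B r hr).map (LinearMap.lcomp k _ w₁)
  let conj : G → FormalIso k A B → FormalIso k A B := fun g w' =>
    ((a.formalIso g⁻¹).trans w').trans (b.formalIso g)
  have hconj : ∀ g (w' : FormalIso k A B),
      ρ g (w'.iso (r + 1)).toLinearMap = ((conj g w').iso (r + 1)).toLinearMap := fun g w' => rfl
  -- Equivariance of `w` at level `r` is what keeps conjugation inside this set.
  have hconj' : ∀ g (w' : FormalIso k A B), (∀ x, w'.iso r x = w.iso r x) →
      ∀ x, (conj g w').iso r x = w.iso r x := by
    intro g w' h x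
    change b.act r g (w'.iso r (a.act r g⁻¹ x)) = _
    rw [h, ← hw, a.act_act_inv]
  have hQ_of : ∀ w' : FormalIso k A B, (∀ x, w'.iso r x = w.iso r x) →
      (w'.iso (r + 1)).toLinearMap - w₁ ∈ Q := by
    intro w' h
    obtain ⟨q, hq, hqx⟩ := FormalIso.exists_deformation w w' r hr h
    refine ⟨q, hq, LinearMap.ext fun x => ?_⟩
    change q (w.iso (r + 1) x) = w'.iso (r + 1) x - w.iso (r + 1) x
    rw [hqx, add_sub_cancel_left]
  have hQ_to : ∀ q ∈ Q, ∃ w' : FormalIso k A B, (∀ x, w'.iso r x = w.iso r x) ∧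
      (w'.iso (r + 1)).toLinearMap = w₁ + q := by
    rintro _ ⟨q, ⟨θ, hθ, rfl⟩, rfl⟩
    refine ⟨w.trans θ, fun x => by rw [FormalIso.trans_iso, hθ], LinearMap.ext fun x => ?_⟩
    change θ.iso (r + 1) (w.iso (r + 1) x) =
      w.iso (r + 1) x + (θ.iso (r + 1) (w.iso (r + 1) x) - w.iso (r + 1) x)
    rw [add_sub_cancel]
  have hw₁ : ∀ g, ρ g w₁ - w₁ ∈ Q := fun g => by
    rw [hconj]
    exact hQ_of _ (hconj' g w fun _ => rfl)
  have hQs : ∀ g, ∀ q ∈ Q, ρ g q ∈ Q := by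
    intro g q hq
    obtain ⟨w', h1, h2⟩ := hQ_to q hq
    have h3 : ρ g q = (((conj g w').iso (r + 1)).toLinearMap - w₁) - (ρ g w₁ - w₁) := by
      rw [← hconj, h2, map_add]; abel
    rw [h3]
    exact sub_mem (hQ_of _ (hconj' g w' h1)) (hw₁ g)
  obtain ⟨q, hq, hfix⟩ := FunctionAlgebra.LinearlyReductive.exists_fixed_point
    (hG.linearlyReductive) hρ Q hQs w₁ hw₁
  obtain ⟨w', h1, h2⟩ := hQ_to q hq
  refine ⟨w', h1, fun g x => ?_⟩
  -- Being fixed by conjugation is equivariance, once evaluated at `g • x`.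
  have h3 := LinearMap.congr_fun (hfix g) (a.act (r + 1) g x)
  rw [← h2] at h3
  change b.act (r + 1) g (w'.iso (r + 1) (a.act (r + 1) g⁻¹ (a.act (r + 1) g x))) =
    w'.iso (r + 1) (a.act (r + 1) g x) at h3
  rw [← h3, a.act_inv_act]

end Equivariance

end StarrLift

/-! ### The limit of the corrections -/

theorem mainTheorem10 {k : Type*} [Field k] [IsAlgClosed k] [CharZero k]
    {n : ℕ} (G : Subgroup (GL (Fin n) k)) (hG : StarrLift.IsReductive G)
    {A B : Type*} [CommRing A] [IsLocalRing A] [Algebra k A]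
    [CommRing B] [IsLocalRing B] [Algebra k B]
    [IsAdicComplete (IsLocalRing.maximalIdeal A) A]
    [IsAdicComplete (IsLocalRing.maximalIdeal B) B]
    (hA : ∀ r : ℕ, Module.Finite k (A ⧸ IsLocalRing.maximalIdeal A ^ (r + 1)))
    (hB : ∀ r : ℕ, Module.Finite k (B ⧸ IsLocalRing.maximalIdeal B ^ (r + 1)))
    (a : StarrLift.FormalAction G A) (b : StarrLift.FormalAction G B)
    (u : StarrLift.FormalIso k A B) (hu : u.IsEquivariantAt a b 1) :
    ∃ v : StarrLift.FormalIso k A B, ∀ r : ℕ, v.IsEquivariantAt a b r := by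
  have step : ∀ (j : ℕ) (w : {w : StarrLift.FormalIso k A B // w.IsEquivariantAt a b (j + 1)}),
      ∃ w' : {w : StarrLift.FormalIso k A B // w.IsEquivariantAt a b (j + 2)},
        ∀ x, w'.1.iso (j + 1) x = w.1.iso (j + 1) x := by
    intro j w
    have := hA (j + 2)
    have := hB (j + 2)
    obtain ⟨w', h1, h2⟩ := StarrLift.FormalIso.exists_isEquivariantAt_succ hG a b (j + 1)
      (by omega) w.1 w.2
    exact ⟨⟨w', h2⟩, h1⟩
  choose next hnext using step
  -- The index is shifted: `w j` is equivariant at level `j + 1`, so the recursion starts from `u`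
  -- at level `1`.
  let w : (j : ℕ) → {w : StarrLift.FormalIso k A B // w.IsEquivariantAt a b (j + 1)} :=
    fun j => Nat.rec ⟨u, hu⟩ next j
  have hw : ∀ j x, (w (j + 1)).1.iso (j + 1) x = (w j).1.iso (j + 1) x :=
    fun j x => hnext j (w j) x
  have hle : ∀ r s, r ≤ s → ∀ x, (w s).1.iso r x = (w r).1.iso r x := by
    intro r s h
    induction s, h using Nat.le_induction with
    | base => intro x; rfl
    | succ s h ih =>
      intro x
      rw [StarrLift.FormalIso.eq_of_le (h.trans (Nat.le_succ s)) (hw s), ih]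
  -- Level `r` no longer changes from `w r` on, so the diagonal is compatible. Equivariance of `w r`
  -- at level `r + 1` descends to level `r`, which also covers `r = 0`.
  refine ⟨⟨fun r => (w r).1.iso r, fun {r s} h x => ?_⟩, fun r => ?_⟩
  · rw [(w s).1.compat h, hle r s h]
  · exact fun g x => StarrLift.FormalIso.IsEquivariantAt.of_le (Nat.le_succ r) (w r).2 g x
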